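/- Let $G_{n,p}$ be the random graph on the vertices $1,\dots,n$ in which each edge is present independently with probability $p$. A feedback vertex set of a graph is a set of vertices that meets every cycle. Throughout, $\log$ is the natural logarithm, $o(1)$ is as $n\to\infty$, and running time is counted in unit-cost steps of a random access program (constants, successor, copying, array access, comparison, and adjacency queries to the input graph). (a) There is a deterministic polynomial-time algorithm that outputs a feedback vertex set $F(G)$ for every input graph $G$ and such that, for every sequence $p=p(n)\in[0,1]$ with $p=o(1)$, for all sufficiently large $n$, $$\Pr\Big[\,|F(G_{n,p})|\le n-\tfrac1p\log(np)\,(1-o(1))\Big]\ \ge\ \tfrac34 .$$ (The right-hand side of the inequality is read as $n$ when $p=0$.) (b) Consider in particular the online algorithm Augment-BFS: start with one arbitrary vertex $v$ as the current level and as the only exposed vertex. In each round, let $K$ be the set of unexposed vertices with a neighbour in the current level $L$, and let $R\subseteq K$ be the set of those with exactly one neighbour in $L$; expose $K$; choose an independent set $L'$ of $G[R]$ greedily, in the order of the vertex labels; delete $K\setminus L'$; and let $L'$ be the new current level. Stop when the current level is empty, and output the set $S_v(G)$ of all vertices that were deleted or never exposed. This algorithm runs in polynomial time, and for every graph $G$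 and every start vertex $v$ the set $S_v(G)$ is a feedback vertex set of $G$. For every sequence $p=p(n)\in[0,1]$ with $p=o(1)$ and $np\to\infty$, for all sufficiently large $n$ and every start vertex $v$, $$\Pr\Big[\,|S_v(G_{n,p})|\le n-\tfrac1p\log(np)\,(1-o(1))\Big]\ \ge\ \tfrac34 ,$$ where the $o(1)$ does not depend on $v$. -/

import Mathlib

open Filter Topology

/-! ## Feedback vertex sets -/

/-- `S` is a feedback vertex set of `G`: every cycle of `G` contains a vertex of `S`. -/
def IsFeedbackVertexSet {V : Type*} (G : SimpleGraph V) (S : Finset V) : Prop :=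
  ∀ ⦃v : V⦄ (c : G.Walk v v), c.IsCycle → ∃ u ∈ c.support, u ∈ S

/-! ## Algorithm Augment-BFS -/

namespace AugmentBFS

/-- The data maintained by the exploration of a graph on `Fin n`. -/
structure State (n : ℕ) where
  /-- vertices reached so far by the breadth-first exploration -/
  exposed : Finset (Fin n)
  /-- exposed vertices that were deleted; a vertex is never removed from this set again -/
  deleted : Finset (Fin n)
  /-- the surviving vertices at the current depth -/
  level : Finset (Fin n)

variable {n : ℕ} (G : SimpleGraph (Fin n))

open Classical in
/-- The unexposed neighbours of the current level. -/
noncomputable def frontier (s : State n) : Finset (Fin n) :=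
  Finset.univ.filter fun u => u ∉ s.exposed ∧ ∃ w ∈ s.level, G.Adj w u

open Classical in
/-- The unexposed vertices that are adjacent to exactly one vertex of the current level. -/
noncomputable def uniqueNeighbors (s : State n) : Finset (Fin n) :=
  (frontier G s).filter fun u => ∃! w, w ∈ s.level ∧ G.Adj w u

open Classical in
/-- The greedy independent set of `G[R]`: scan the vertices in increasing order, and add a vertex of
`R` whenever it has no neighbour among the vertices that have been added before. -/
noncomputable def greedyIndepSet (R : Finset (Fin n)) : Finset (Fin n) :=
  (List.finRange n).foldl
    (fun I u => if u ∈ R ∧ ∀ w ∈ I, ¬ G.Adj w u then insert u I else I) ∅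

/-- One level of the exploration: expose the unexposed neighbours of the current level, keep
a greedy independent set among the unique ones as the next level, and delete all the others. -/
noncomputable def step (s : State n) : State n where
  exposed := s.exposed ∪ frontier G s
  deleted := s.deleted ∪ (frontier G s \ greedyIndepSet G (uniqueNeighbors G s))
  level := greedyIndepSet G (uniqueNeighbors G s)

/-- The exploration starts with the single surviving vertex `v`. -/
def init (v : Fin n) : State n where
  exposed := {v}
  deleted := ∅
  level := {v}

/-- The output of the algorithm started at `v`: all vertices that do not survive, that is, the
deleted ones and those that are never reached. The exploration stops when the current level is
empty. A nonempty new level exposes at least one new vertex, so this is the case after at most `n`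
rounds, and a round with an empty level changes nothing; hence `n` rounds are performed. -/
noncomputable def output (v : Fin n) : Finset (Fin n) :=
  ((step G)^[n] (init v)).deleted ∪ (Finset.univ \ ((step G)^[n] (init v)).exposed)

end AugmentBFS

/-! ## Machine model: random access programs with unit-cost steps -/

namespace RAM

/-- Programs with variables and arrays that hold natural numbers. Variables and arrays
are named by natural numbers. The only arithmetic operations are constants and the successor. -/
inductive Program where
  /-- do nothing -/
  | skip : Program
  /-- `x := k` -/
  | const (x k : ℕ) : Program
  /-- `x := y` -/
  | copy (x y : ℕ) : Program
  /-- `x := x + 1` -/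
  | succ (x : ℕ) : Program
  /-- `x := a[i]` -/
  | read (x a i : ℕ) : Program
  /-- `a[i] := x` -/
  | write (a i x : ℕ) : Program
  /-- `x := 1` if the vertices with numbers `i` and `j` are adjacent in the input graph,
  and `x := 0` otherwise -/
  | adj (x i j : ℕ) : Program
  /-- first `c`, then `d` -/
  | seq (c d : Program) : Program
  /-- if `x < y` then `c` else `d` -/
  | ite (x y : ℕ) (c d : Program) : Program
  /-- while `x < y` do `c` -/
  | while (x y : ℕ) (c : Program) : Program

/-- The memory: the values of the variables, and the entries of the arrays. -/
@[ext]
structure Memory where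
  /-- the value of each variable -/
  var : ℕ → ℕ
  /-- the entries of each array -/
  arr : ℕ → ℕ → ℕ

/-- Assign the value `k` to the variable `x`. -/
def Memory.setVar (m : Memory) (x k : ℕ) : Memory :=
  { m with var := Function.update m.var x k }

/-- Assign the value `k` to the entry number `i` of the array `a`. -/
def Memory.setArr (m : Memory) (a i k : ℕ) : Memory :=
  { m with arr := Function.update m.arr a (Function.update (m.arr a) i k) }

open Classical in
/-- The entry at `(i, j)` of the adjacency matrix of `G` (and `0` outside of the matrix). -/
noncomputable def adjEntry {n : ℕ} (G : SimpleGraph (Fin n)) (i j : ℕ) : ℕ :=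
  if ∃ u w : Fin n, (u : ℕ) = i ∧ (w : ℕ) = j ∧ G.Adj u w then 1 else 0

/-- `Exec G c m t m'`: with input graph `G` and from the memory `m`, the program `c` halts after
exactly `t` steps with the memory `m'`. Every assignment, every adjacency query and every evaluation
of the condition of a branch or of a loop is one step. -/
inductive Exec {n : ℕ} (G : SimpleGraph (Fin n)) : Program → Memory → ℕ → Memory → Prop where
  | skip (m : Memory) : Exec G .skip m 1 m
  | const (x k : ℕ) (m : Memory) : Exec G (.const x k) m 1 (m.setVar x k)
  | copy (x y : ℕ) (m : Memory) : Exec G (.copy x y) m 1 (m.setVar x (m.var y))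
  | succ (x : ℕ) (m : Memory) : Exec G (.succ x) m 1 (m.setVar x (m.var x + 1))
  | read (x a i : ℕ) (m : Memory) :
      Exec G (.read x a i) m 1 (m.setVar x (m.arr a (m.var i)))
  | write (a i x : ℕ) (m : Memory) :
      Exec G (.write a i x) m 1 (m.setArr a (m.var i) (m.var x))
  | adj (x i j : ℕ) (m : Memory) :
      Exec G (.adj x i j) m 1 (m.setVar x (adjEntry G (m.var i) (m.var j)))
  | seq {c d : Program} {m m' m'' : Memory} {t t' : ℕ}
      (hc : Exec G c m t m') (hd : Exec G d m' t' m'') : Exec G (.seq c d) m (t + t') m''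
  | ite_true {x y : ℕ} {c d : Program} {m m' : Memory} {t : ℕ}
      (h : m.var x < m.var y) (hc : Exec G c m t m') : Exec G (.ite x y c d) m (t + 1) m'
  | ite_false {x y : ℕ} {c d : Program} {m m' : Memory} {t : ℕ}
      (h : ¬ m.var x < m.var y) (hd : Exec G d m t m') : Exec G (.ite x y c d) m (t + 1) m'
  | while_true {x y : ℕ} {c : Program} {m m' m'' : Memory} {t t' : ℕ}
      (h : m.var x < m.var y) (hc : Exec G c m t m') (hw : Exec G (.while x y c) m' t' m'') :
      Exec G (.while x y c) m (t + t' + 1) m''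
  | while_false {x y : ℕ} {c : Program} {m : Memory}
      (h : ¬ m.var x < m.var y) : Exec G (.while x y c) m 1 m

/-- The initial memory: variable `0` holds the number `n` of vertices, variable `1` holds the
(number of the) vertex `v`, and everything else is `0`. -/
def initial (n : ℕ) (v : Fin n) : Memory where
  var x := if x = 0 then n else if x = 1 then v else 0
  arr _ _ := 0

/-- `F`, which maps a graph on `Fin n` with a distinguished vertex to a set of vertices, is
computable in polynomial time: one program halts on every input after at most `P n` steps, with `P`
a polynomial, and then array `0` marks exactly the vertices in the set by the value `1`. -/
def ComputableInPolyTime (F : (n : ℕ) → SimpleGraph (Fin n) → Fin n → Finset (Fin n)) : Prop :=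
  ∃ (c : Program) (P : Polynomial ℕ), ∀ (n : ℕ) (G : SimpleGraph (Fin n)) (v : Fin n),
    ∃ (t : ℕ) (m : Memory), Exec G c (initial n v) t m ∧ t ≤ P.eval n ∧
      ∀ u : Fin n, m.arr 0 u = 1 ↔ u ∈ F n G v

end RAM

/-! ## Independence in the binomial random graph -/

namespace RandomGraph

open MeasureTheory ProbabilityTheory SimpleGraph unitInterval

variable {V : Type*} {α : Type*}

/-! Write q = 1 - p. Both guarantees rest on one fact about greedy independent sets
(`real_greedyIndepSet_lt_le`): in the random graph on a fixed vertex set R, the greedy set has at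
least log(1 + cp|R|) / (-log q) elements, except with probability cp / (1 - c)². When m vertices
have been chosen, the next candidate is accepted with probability q^m, so the scan time minus the
sum of q^(-i) over i < m is a martingale; its second moment and Chebyshev give the bound.

For (a), the complement of the greedy independent set of the whole graph suffices. An independent
set contains no cycle, and with R all vertices and c tending to 1 slowly its size is (1 - o(1))
log(np) / p when np ≥ 1; when np < 1 the required saving is not positive.

For (b), the survivors induce a forest: a newly kept vertex has exactly one neighbour among the
earlier survivors, namely in the last level, and none among the vertices kept with it
(`ForestInvariant.step`). To count them, let S be the number of survivors, l the size of the level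
and U the number of unexposed vertices. The invariant `OnTrack` says that either S has reached
log(np/A) / (-log q), or l ≥ 2^i after i rounds and q^l U is at least (1 - δ)^i q^S (n - 1). In the
second case, if the target is not met, about lpq^(l-1)U vertices are candidates for the next level.
If l is below 16/(Ap), the greedy bound at least doubles the level. Otherwise it yields so many new
vertices that S reaches the target in this very round (`OnTrack.advance`). Since levels at least
double, N rounds with 2^N p ≥ 2 are enough.

Each round uses fresh randomness: the pairs that determined the current state are disjoint from
those that determine the next step (`integral_resample`, `determinedBy_iterate_step`). The failure
probabilities sum to at most 18 N³ p + 32/A (`real_survivors_lt_le`). With N of order p^(-1/3) and A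
= exp √(log np) this is at most 1/4, while log A = o(log np).

Polynomial running time is proved by a Hoare-style calculus for the machine (`Runs`), with loop
invariants (`runs_forLoop`). -/

/-- The value of `f` at a graph only depends on which of the pairs in `S` are edges. -/
def DeterminedBy (S : Set (Sym2 V)) (f : SimpleGraph V → α) : Prop :=
  ∀ ⦃G H : SimpleGraph V⦄, (∀ e ∈ S, e ∈ G.edgeSet ↔ e ∈ H.edgeSet) → f G = f H

/-- The pairs with one element in `A` and the other one in `B`. -/
def between (A B : Set V) : Set (Sym2 V) := {e | ∃ a ∈ A, ∃ b ∈ B, e = s(a, b)}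

lemma mem_between {A B : Set V} {a b : V} (ha : a ∈ A) (hb : b ∈ B) : s(a, b) ∈ between A B :=
  ⟨a, ha, b, hb, rfl⟩

lemma DeterminedBy.mono {S T : Set (Sym2 V)} {f : SimpleGraph V → α} (hf : DeterminedBy S f)
    (h : S ⊆ T) : DeterminedBy T f := fun _ _ hGH => hf fun e he => hGH e (h he)

lemma DeterminedBy.comp {β : Type*} {S : Set (Sym2 V)} {f : SimpleGraph V → α}
    (hf : DeterminedBy S f) (g : α → β) : DeterminedBy S (fun G => g (f G)) :=
  fun _ _ hGH => congrArg g (hf hGH)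

section Finite

variable [Finite V]

instance : DiscreteMeasurableSpace (SimpleGraph V) := by
  have : MeasurableSingletonClass (SimpleGraph V) := by
    refine ⟨fun G => ?_⟩
    have h : ({G} : Set (SimpleGraph V)) = edgeSet ⁻¹' {G.edgeSet} := by
      ext H; simp
    rw [h]
    exact measurable_edgeSet (measurableSet_singleton _)
  infer_instance

lemma integrable (p : I) (f : SimpleGraph V → ℝ) : Integrable f (binomialRandom V p) :=
  .of_finite

/-- The law of a single pair: an edge with probability `p`, unless it is on the diagonal. -/
noncomputable def pairLaw (p : I) (e : Sym2 V) : Measure Prop :=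
  toNNReal p • .dirac (e ∈ Sym2.diagSetᶜ) + toNNReal (σ p) • .dirac False

instance (p : I) (e : Sym2 V) : IsProbabilityMeasure (pairLaw p e) := by
  unfold pairLaw; infer_instance

/-- The graph whose edges are the pairs chosen by `ω`. -/
def graphOf (ω : Sym2 V → Prop) : SimpleGraph V := fromEdgeSet {e | ω e}

omit [Finite V] in
lemma measurable_graphOf : Measurable (graphOf : (Sym2 V → Prop) → SimpleGraph V) :=
  measurable_fromEdgeSet.comp MeasurableEquiv.setOfPred.measurable

lemma binomialRandom_eq_map_graphOf (p : I) :
    binomialRandom V p = (Measure.infinitePi (pairLaw (V := V) p)).map graphOf := by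
  rw [binomialRandom_eq_map, setBernoulli_eq_map, Measure.map_map]
  · rfl
  · exact measurable_fromEdgeSet
  · exact MeasurableEquiv.setOfPred.measurable

/-- The pairs are independent coordinates of a product measure, and functions of disjoint blocks of
coordinates are independent. -/
lemma integral_mul_eq (p : I) {S T : Set (Sym2 V)} (hST : Disjoint S T)
    {f g : SimpleGraph V → ℝ} (hf : DeterminedBy S f) (hg : DeterminedBy T g) :
    ∫ G, f G * g G ∂(binomialRandom V p) =
      (∫ G, f G ∂(binomialRandom V p)) * ∫ G, g G ∂(binomialRandom V p) := by
  classical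
  have := Fintype.ofFinite V
  simp only [binomialRandom_eq_map_graphOf]
  rw [integral_map measurable_graphOf.aemeasurable Measurable.of_discrete.aestronglyMeasurable,
    integral_map measurable_graphOf.aemeasurable Measurable.of_discrete.aestronglyMeasurable,
    integral_map measurable_graphOf.aemeasurable Measurable.of_discrete.aestronglyMeasurable]
  -- A function determined by U factors through the coordinates in U: those outside may be set to
  -- `False`.
  have key : ∀ {U : Set (Sym2 V)} {h : SimpleGraph V → ℝ}, DeterminedBy U h →
      (fun ω => h (graphOf ω)) = (fun x : U.toFinset → Prop =>
        h (graphOf fun e => ∃ he : e ∈ U.toFinset, x ⟨e, he⟩)) ∘ (fun ω i => ω i) := by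
    intro U h hh
    funext ω
    refine hh fun e he => ?_
    simp [graphOf, he]
  have hind : iIndepFun (fun (i : Sym2 V) (ω : Sym2 V → Prop) => ω i)
      (Measure.infinitePi (pairLaw (V := V) p)) :=
    iIndepFun_infinitePi (X := fun _ x => x) fun _ => measurable_id
  have := hind.indepFun_finset S.toFinset T.toFinset (by simpa using hST)
    (fun i => measurable_pi_apply i)
  have h2 := this.comp (φ := fun x : S.toFinset → Prop =>
        f (graphOf fun e => ∃ he : e ∈ S.toFinset, x ⟨e, he⟩)) (ψ := fun x : T.toFinset → Prop =>
        g (graphOf fun e => ∃ he : e ∈ T.toFinset, x ⟨e, he⟩)) .of_discrete .of_discrete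
  rw [show _ ∘ _ = _ from (key hf).symm, show _ ∘ _ = _ from (key hg).symm] at h2
  refine h2.integral_fun_mul_eq_mul_integral ?_ ?_
  · rw [key hf]; exact (Measurable.of_discrete.comp (by fun_prop)).aestronglyMeasurable
  · rw [key hg]; exact (Measurable.of_discrete.comp (by fun_prop)).aestronglyMeasurable

/-- A quantity `h a` that is independent of the event `X = a`, for every `a`, may be averaged over
a fresh random graph before the random value `X` is inserted for `a`. -/
lemma integral_resample [Finite α] (p : I) {X : SimpleGraph V → α} {h : α → SimpleGraph V → ℝ}
    {S T : α → Set (Sym2 V)} (hST : ∀ a, Disjoint (S a) (T a))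
    (hX : ∀ a, DeterminedBy (S a) (fun G => X G = a)) (hh : ∀ a, DeterminedBy (T a) (h a)) :
    ∫ G, h (X G) G ∂(binomialRandom V p) =
      ∫ G, (∫ H, h (X G) H ∂(binomialRandom V p)) ∂(binomialRandom V p) := by
  classical
  have := Fintype.ofFinite α
  have e1 : ∀ G, h (X G) G = ∑ a, (if X G = a then 1 else 0) * h a G := by
    intro G; simp
  have e2 : ∀ G, (∫ H, h (X G) H ∂(binomialRandom V p)) =
      ∑ a, (if X G = a then 1 else 0) * (∫ H, h a H ∂(binomialRandom V p)) := by
    intro G; simp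
  simp only [e1, e2]
  rw [integral_finsetSum _ fun _ _ => integrable _ _,
    integral_finsetSum _ fun _ _ => integrable _ _]
  refine Finset.sum_congr rfl fun a _ => ?_
  rw [integral_mul_eq p (hST a) _ (hh a), integral_mul_const]
  exact (hX a).comp (fun P : Prop => if P then (1 : ℝ) else 0)

lemma integral_mono' (p : I) {f g : SimpleGraph V → ℝ} (h : ∀ G, f G ≤ g G) :
    ∫ G, f G ∂(binomialRandom V p) ≤ ∫ G, g G ∂(binomialRandom V p) :=
  integral_mono (integrable p f) (integrable p g) h

lemma real_eq_integral (p : I) (P : SimpleGraph V → Prop) [DecidablePred P] :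
    (binomialRandom V p).real {G | P G} =
      ∫ G, (if P G then 1 else 0 : ℝ) ∂(binomialRandom V p) := by
  rw [← integral_indicator_one (MeasurableSet.of_discrete)]
  simp only [Set.indicator_apply, Set.mem_ofPred_eq, Pi.one_apply]

/-- Chebyshev's inequality for the number of the events that happen, among events with the same
probability that are determined by disjoint sets of pairs. -/
lemma real_count_le [DecidableEq V] (p : I) (U : Finset V) {a δ : ℝ} (hδ : 0 < δ)
    (ha : 0 < a * U.card)
    {P : V → SimpleGraph V → Prop} [∀ x G, Decidable (P x G)] {T : V → Set (Sym2 V)}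
    (hP : ∀ x ∈ U, DeterminedBy (T x) (P x))
    (hT : ∀ x ∈ U, ∀ y ∈ U, x ≠ y → Disjoint (T x) (T y))
    (hPa : ∀ x ∈ U, (binomialRandom V p).real {G | P x G} = a) :
    (binomialRandom V p).real {G | ((U.filter (P · G)).card : ℝ) ≤ (1 - δ) * (a * U.card)} ≤
      1 / (δ ^ 2 * (a * U.card)) := by
  classical
  set μ := binomialRandom V p with hμ
  set M := a * U.card with hM
  set f : V → SimpleGraph V → ℝ := fun x G => if P x G then 1 else 0 with hf
  have hfP : ∀ x ∈ U, DeterminedBy (T x) (f x) := fun x hx G H hGH => by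
    simp only [hf, hP x hx hGH]
  have hfa : ∀ x ∈ U, ∫ G, f x G ∂μ = a := fun x hx => by
    rw [← hPa x hx, real_eq_integral]
  have hcard : ∀ G, ((U.filter (P · G)).card : ℝ) = ∑ x ∈ U, f x G := by
    intro G; simp [hf]
  have hsum : ∫ G, (∑ x ∈ U, f x G) ∂μ = M := by
    rw [integral_finsetSum _ fun _ _ => integrable _ _, Finset.sum_congr rfl hfa]
    simp [hM, mul_comm]
  -- The off-diagonal terms give a² by independence, and a diagonal term gives only a, because an
  -- indicator equals its square.
  have hsq : ∫ G, (∑ x ∈ U, f x G) ^ 2 ∂μ ≤ M ^ 2 + M := by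
    have : ∀ G, (∑ x ∈ U, f x G) ^ 2 = ∑ x ∈ U, ∑ y ∈ U, f x G * f y G := by
      intro G; rw [sq, Finset.sum_mul_sum]
    simp only [this]
    rw [integral_finsetSum _ fun _ _ => integrable _ _]
    have hle : ∀ x ∈ U, ∫ G, (∑ y ∈ U, f x G * f y G) ∂μ ≤ a * M + a := by
      intro x hx
      rw [integral_finsetSum _ fun _ _ => integrable _ _]
      have : ∀ y ∈ U, ∫ G, f x G * f y G ∂μ ≤ a * a + if x = y then a else 0 := by
        intro y hy
        by_cases hxy : x = y
        · subst hxy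
          have : ∀ G, f x G * f x G = f x G := by intro G; simp [hf]
          simp only [this, hfa x hx, if_true]
          nlinarith [sq_nonneg a]
        · rw [integral_mul_eq p (hT x hx y hy hxy) (hfP x hx) (hfP y hy), hfa x hx, hfa y hy]
          simp [hxy]
      refine (Finset.sum_le_sum this).trans ?_
      rw [Finset.sum_add_distrib]
      simp [hx, hM]
      nlinarith
    refine (Finset.sum_le_sum hle).trans ?_
    simp [hM]
    nlinarith
  have hvar : ∫ G, ((∑ x ∈ U, f x G) - M) ^ 2 ∂μ ≤ M := by
    have : ∀ G, ((∑ x ∈ U, f x G) - M) ^ 2 =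
        (∑ x ∈ U, f x G) ^ 2 - 2 * M * (∑ x ∈ U, f x G) + M ^ 2 := by intro G; ring
    simp only [this]
    rw [integral_add (integrable _ _) (integrable _ _),
      integral_sub (integrable _ _) (integrable _ _), integral_const_mul, hsum]
    simp
    nlinarith
  have hmain : (δ * M) ^ 2 *
      μ.real {G | ((U.filter (P · G)).card : ℝ) ≤ (1 - δ) * M} ≤ M := by
    refine le_trans ?_ hvar
    rw [real_eq_integral, ← integral_const_mul]
    refine integral_mono' p fun G => ?_
    simp only [hcard]
    split_ifs with h
    · rw [mul_one]
      have : δ * M ≤ M - ∑ x ∈ U, f x G := by linarith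
      nlinarith [mul_pos hδ ha]
    · simp; positivity
  rw [le_div_iff₀ (by positivity)]
  have : 0 < M := ha
  nlinarith

open Classical in
lemma integral_adj (p : I) {a b : V} (hab : a ≠ b) :
    ∫ G, (if G.Adj a b then 1 else 0 : ℝ) ∂(binomialRandom V p) = p := by
  rw [← real_eq_integral, measureReal_def, binomialRandom_eq_map_graphOf,
    Measure.map_apply measurable_graphOf .of_discrete]
  have : graphOf ⁻¹' {G : SimpleGraph V | G.Adj a b} =
      (fun ω : Sym2 V → Prop => ω s(a, b)) ⁻¹' {True} := by
    ext ω; simp [graphOf, hab]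
  rw [this, ← Measure.map_apply (measurable_pi_apply _) .of_discrete, Measure.infinitePi_map_eval]
  simp [pairLaw, hab]

open Classical in
/-- The probability that `x` has no neighbour in `A`. -/
lemma integral_forall_not_adj (p : I) (A : Finset V) {x : V} (hx : x ∉ A) :
    ∫ G, (if ∀ w ∈ A, ¬ G.Adj w x then 1 else 0 : ℝ) ∂(binomialRandom V p) =
      (1 - (p : ℝ)) ^ A.card := by
  induction A using Finset.induction_on with
  | empty => simp
  | insert a A ha ih =>
    simp only [Finset.mem_insert, not_or] at hx
    have e : ∀ G : SimpleGraph V, (if ∀ w ∈ insert a A, ¬ G.Adj w x then 1 else 0 : ℝ) =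
        (1 - if G.Adj a x then 1 else 0) * (if ∀ w ∈ A, ¬ G.Adj w x then 1 else 0) := by
      intro G
      by_cases h : G.Adj a x <;> simp [h]
    simp only [e]
    rw [integral_mul_eq p (S := {s(a, x)}) (T := between A {x}), ih hx.2,
      integral_sub (integrable _ _) (integrable _ _), integral_adj p (Ne.symm hx.1),
      Finset.card_insert_of_notMem ha]
    · simp [pow_succ, mul_comm]
    · rw [Set.disjoint_singleton_left]
      rintro ⟨w, hw, y, rfl, hwy⟩
      simp only [Sym2.eq_iff] at hwy
      rcases hwy with ⟨rfl, -⟩ | ⟨rfl, rfl⟩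
      · exact ha hw
      · exact hx.1 rfl
    · intro G H hGH
      have := hGH s(a, x) rfl
      simp only [mem_edgeSet] at this
      simp only [this]
    · intro G H hGH
      have : ∀ w ∈ A, (G.Adj w x ↔ H.Adj w x) := fun w hw =>
        hGH s(w, x) (mem_between (by simpa using hw) rfl)
      simp +contextual only [this]

/-- The probability that `x` has no neighbour in `A`. -/
lemma real_forall_not_adj (p : I) (A : Finset V) {x : V} (hx : x ∉ A) :
    (binomialRandom V p).real {G | ∀ w ∈ A, ¬ G.Adj w x} = (1 - (p : ℝ)) ^ A.card := by
  classical
  rw [real_eq_integral, ← integral_forall_not_adj p A hx]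

open Classical in
/-- The probability that `x` has exactly one neighbour in `A`. -/
lemma integral_existsUnique_adj (p : I) (A : Finset V) {x : V} (hx : x ∉ A) :
    ∫ G, (if ∃! w, w ∈ A ∧ G.Adj w x then 1 else 0 : ℝ) ∂(binomialRandom V p) =
      A.card * p * (1 - (p : ℝ)) ^ (A.card - 1) := by
  -- Split according to which vertex a of A is the only neighbour; at most one summand is nonzero,
  -- and each is a product over disjoint sets of pairs.
  have e : ∀ G : SimpleGraph V, (if ∃! w, w ∈ A ∧ G.Adj w x then 1 else 0 : ℝ) =
      ∑ a ∈ A, (if G.Adj a x then 1 else 0) * (if ∀ w ∈ A.erase a, ¬ G.Adj w x then 1 else 0) := by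
    intro G
    split_ifs with h
    · obtain ⟨a, ⟨ha, hax⟩, huniq⟩ := h
      rw [Finset.sum_eq_single_of_mem a ha]
      · rw [if_pos hax, if_pos, mul_one]
        intro w hw hwx
        exact (Finset.mem_erase.1 hw).1 (huniq w ⟨(Finset.mem_erase.1 hw).2, hwx⟩)
      · intro b hb hba
        rw [if_neg, zero_mul]
        exact fun h => hba (huniq b ⟨hb, h⟩)
    · rw [Finset.sum_eq_zero]
      intro a ha
      by_cases hax : G.Adj a x
      · rw [if_neg (c := ∀ w ∈ A.erase a, ¬ G.Adj w x), mul_zero]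
        intro h'
        refine h ⟨a, ⟨ha, hax⟩, fun w hw => ?_⟩
        by_contra hne
        exact h' w (Finset.mem_erase.2 ⟨hne, hw.1⟩) hw.2
      · simp [hax]
  simp only [e]
  rw [integral_finsetSum _ fun _ _ => integrable _ _]
  have : ∀ a ∈ A, ∫ G, (if G.Adj a x then 1 else 0 : ℝ) *
      (if ∀ w ∈ A.erase a, ¬ G.Adj w x then 1 else 0) ∂(binomialRandom V p) =
      p * (1 - (p : ℝ)) ^ (A.card - 1) := by
    intro a ha
    have hax : a ≠ x := fun h => hx (h ▸ ha)
    rw [integral_mul_eq p (S := {s(a, x)}) (T := between ↑(A.erase a) {x}), integral_adj p hax,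
      integral_forall_not_adj p _ (fun h => hx (Finset.mem_of_mem_erase h)),
      Finset.card_erase_of_mem ha]
    · rw [Set.disjoint_singleton_left]
      rintro ⟨w, hw, y, rfl, hwy⟩
      simp only [Sym2.eq_iff] at hwy
      rcases hwy with ⟨rfl, -⟩ | ⟨rfl, rfl⟩
      · simp at hw
      · exact hax rfl
    · intro G H hGH
      have := hGH s(a, x) rfl
      simp only [mem_edgeSet] at this
      simp only [this]
    · intro G H hGH
      have : ∀ w ∈ A.erase a, (G.Adj w x ↔ H.Adj w x) := fun w hw =>
        hGH s(w, x) (mem_between (Finset.mem_coe.2 hw) rfl)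
      simp +contextual only [this]
  rw [Finset.sum_congr rfl this]
  simp [mul_assoc]

/-- The probability that `x` has exactly one neighbour in `A`. -/
lemma real_existsUnique_adj (p : I) (A : Finset V) {x : V} (hx : x ∉ A) :
    (binomialRandom V p).real {G | ∃! w, w ∈ A ∧ G.Adj w x} =
      A.card * p * (1 - (p : ℝ)) ^ (A.card - 1) := by
  classical
  rw [real_eq_integral, ← integral_existsUnique_adj p A hx]

end Finite

end RandomGraph

/-! ## The greedy independent set -/

namespace AugmentBFS

variable {n : ℕ} (G : SimpleGraph (Fin n))

open Classical in
/-- The greedy independent set of `G[R]` after scanning the vertices of the list `l`. -/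
noncomputable def greedyPrefix (R : Finset (Fin n)) (l : List (Fin n)) : Finset (Fin n) :=
  l.foldl (fun I u => if u ∈ R ∧ ∀ w ∈ I, ¬ G.Adj w u then insert u I else I) ∅

lemma greedyPrefix_finRange (R : Finset (Fin n)) :
    greedyPrefix G R (List.finRange n) = greedyIndepSet G R := rfl

@[simp] lemma greedyPrefix_nil (R : Finset (Fin n)) : greedyPrefix G R [] = ∅ := rfl

open Classical in
lemma greedyPrefix_concat (R : Finset (Fin n)) (l : List (Fin n)) (u : Fin n) :
    greedyPrefix G R (l ++ [u]) =
      if u ∈ R ∧ ∀ w ∈ greedyPrefix G R l, ¬ G.Adj w u then insert u (greedyPrefix G R l)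
      else greedyPrefix G R l := by
  rw [greedyPrefix, List.foldl_append]
  rfl

lemma greedyPrefix_subset (R : Finset (Fin n)) (l : List (Fin n)) :
    ∀ u ∈ greedyPrefix G R l, u ∈ R ∧ u ∈ l := by
  induction l using List.reverseRecOn with
  | nil => simp
  | append_singleton l a ih =>
    intro u hu
    rw [greedyPrefix_concat] at hu
    split_ifs at hu with h
    · rcases Finset.mem_insert.1 hu with rfl | hu
      · exact ⟨h.1, by simp⟩
      · exact ⟨(ih u hu).1, by simp [(ih u hu).2]⟩
    · exact ⟨(ih u hu).1, by simp [(ih u hu).2]⟩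

lemma greedyPrefix_indep (R : Finset (Fin n)) (l : List (Fin n)) :
    ∀ u ∈ greedyPrefix G R l, ∀ w ∈ greedyPrefix G R l, ¬ G.Adj u w := by
  induction l using List.reverseRecOn with
  | nil => simp
  | append_singleton l a ih =>
    rw [greedyPrefix_concat]
    split_ifs with h
    · intro u hu w hw
      rcases Finset.mem_insert.1 hu with rfl | hu <;> rcases Finset.mem_insert.1 hw with rfl | hw
      · exact G.loopless.irrefl _
      · exact fun h' => h.2 w hw h'.symm
      · exact h.2 u (by assumption)
      · exact ih u hu w hw
    · exact ih

lemma greedyIndepSet_subset (R : Finset (Fin n)) : greedyIndepSet G R ⊆ R :=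
  fun u hu => (greedyPrefix_subset G R (List.finRange n) u hu).1

lemma greedyIndepSet_indep (R : Finset (Fin n)) :
    ∀ u ∈ greedyIndepSet G R, ∀ w ∈ greedyIndepSet G R, ¬ G.Adj u w :=
  greedyPrefix_indep G R (List.finRange n)

end AugmentBFS

/-! ### Concentration of the greedy independent set in the random graph. -/

namespace RandomGraph

open MeasureTheory ProbabilityTheory SimpleGraph unitInterval AugmentBFS

variable {n : ℕ}

lemma determinedBy_greedyPrefix (R : Finset (Fin n)) (l : List (Fin n)) :
    DeterminedBy (between {x | x ∈ R ∧ x ∈ l} {x | x ∈ R ∧ x ∈ l})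
      (fun G => greedyPrefix G R l) := by
  induction l using List.reverseRecOn with
  | nil => intro G H _; simp
  | append_singleton l a ih =>
    intro G H hGH
    have ih' : greedyPrefix G R l = greedyPrefix H R l := ih fun e ⟨x, hx, y, hy, he⟩ =>
      hGH e ⟨x, ⟨hx.1, by simp [hx.2]⟩, y, ⟨hy.1, by simp [hy.2]⟩, he⟩
    have : (a ∈ R ∧ ∀ w ∈ greedyPrefix H R l, ¬ G.Adj w a) ↔
        (a ∈ R ∧ ∀ w ∈ greedyPrefix H R l, ¬ H.Adj w a) := by
      refine and_congr_right fun ha => forall₂_congr fun w hw => not_congr ?_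
      obtain ⟨hwR, hwl⟩ := greedyPrefix_subset H R l w hw
      exact hGH s(w, a) (mem_between ⟨hwR, by simp [hwl]⟩ ⟨ha, by simp⟩)
    simp only [greedyPrefix_concat]
    rw [ih']
    by_cases h : a ∈ R ∧ ∀ w ∈ greedyPrefix H R l, ¬ G.Adj w a
    · rw [if_pos h, if_pos (this.1 h)]
    · rw [if_neg h, if_neg (fun h' => h (this.2 h'))]

lemma determinedBy_greedyIndepSet (R : Finset (Fin n)) :
    DeterminedBy (between R R) (fun G => greedyIndepSet G R) :=
  (determinedBy_greedyPrefix R (List.finRange n)).mono fun _ ⟨x, hx, y, hy, he⟩ =>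
    ⟨x, hx.1, y, hy.1, he⟩

/-- The expected number of vertices that the greedy algorithm scans until it finds an independent
set of size `m`, when a pair is a non-edge with probability `q`. -/
noncomputable def expectedScans (q : ℝ) (m : ℕ) : ℝ := ∑ i ∈ Finset.range m, (q ^ i)⁻¹

/-- The geometric sum makes the left side equal to q (q^(-m) - 1). -/
lemma mul_expectedScans_le {q : ℝ} (hq : 0 < q) (m : ℕ) :
    (1 - q) * expectedScans q m ≤ (q ^ m)⁻¹ - 1 := by
  induction m with
  | zero => simp [expectedScans]
  | succ m ih =>
    rw [expectedScans, Finset.sum_range_succ, ← expectedScans, mul_add]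
    have : (q ^ m)⁻¹ = q * (q ^ (m + 1))⁻¹ := by field_simp; ring
    have h0 : 0 < (q ^ (m + 1))⁻¹ := by positivity
    have h1 : (1 - q) * (q ^ m)⁻¹ ≤ (q ^ (m + 1))⁻¹ - (q ^ m)⁻¹ := by
      rw [this]
      nlinarith [sq_nonneg (1 - q)]
    linarith

lemma expectedScans_mono {q : ℝ} (hq : 0 < q) {m k : ℕ} (h : m ≤ k) :
    expectedScans q m ≤ expectedScans q k :=
  Finset.sum_le_sum_of_subset_of_nonneg (by simpa using h) fun i _ _ => by positivity

/-- The squared deviation of the number `j` of scanned vertices from its expectation, as long as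
the independent set has fewer than `k` elements. -/
noncomputable def deviation (q : ℝ) (k j m : ℕ) : ℝ :=
  if m < k then ((j : ℝ) - expectedScans q m) ^ 2 else 0

/-- The deviation D becomes D + 1 - q^(-m) with probability q^m and D + 1 otherwise. Its mean is
again D and the increment has variance q^(-m) - 1, which is at most the bound while m < k. Setting
the value to 0 from k on stops the process and can only lower the left side. -/
lemma deviation_step {q : ℝ} (hq : 0 < q) (hq1 : q ≤ 1) (k j m : ℕ) :
    q ^ m * deviation q k (j + 1) (m + 1) + (1 - q ^ m) * deviation q k (j + 1) m ≤
      deviation q k j m + ((q ^ (k - 1))⁻¹ - 1) := by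
  have hV : ∀ i : ℕ, 1 ≤ (q ^ i)⁻¹ := fun i => (one_le_inv₀ (by positivity)).2 (pow_le_one₀ hq.le hq1)
  by_cases hm : m < k
  · have h1 : deviation q k (j + 1) (m + 1) ≤
        ((j : ℝ) - expectedScans q m + 1 - (q ^ m)⁻¹) ^ 2 := by
      unfold deviation
      split_ifs
      · apply le_of_eq
        rw [expectedScans, Finset.sum_range_succ, ← expectedScans]
        push_cast
        ring
      · positivity
    have h2 : (q ^ m)⁻¹ ≤ (q ^ (k - 1))⁻¹ :=
      inv_anti₀ (by positivity) (pow_le_pow_of_le_one hq.le hq1 (by omega))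
    have h3 : deviation q k (j + 1) m = ((j : ℝ) - expectedScans q m + 1) ^ 2 := by
      rw [deviation, if_pos hm]; push_cast; ring
    have h4 : deviation q k j m = ((j : ℝ) - expectedScans q m) ^ 2 := by
      rw [deviation, if_pos hm]
    rw [h3, h4]
    generalize (j : ℝ) - expectedScans q m = D at *
    have hQ : 0 < q ^ m := by positivity
    have h5 := mul_le_mul_of_nonneg_left h1 hQ.le
    have h6 : q ^ m * (D + 1 - (q ^ m)⁻¹) ^ 2 + (1 - q ^ m) * (D + 1) ^ 2 =
        D ^ 2 + ((q ^ m)⁻¹ - 1) := by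
      field_simp
      ring
    linarith
  · have h1 : deviation q k (j + 1) (m + 1) = 0 := if_neg (by omega)
    have h2 : deviation q k (j + 1) m = 0 := if_neg hm
    have h3 : deviation q k j m = 0 := if_neg hm
    rw [h1, h2, h3]
    linarith [hV (k - 1)]

/-- One martingale step per scanned element of R. Whether the next vertex u is accepted depends on
pairs between u and the chosen set, which are disjoint from the pairs among the vertices scanned
before, so the acceptance probability can be computed for a fixed chosen set. -/
lemma integral_deviation_le (p : I) (hp : (p : ℝ) < 1) (k : ℕ) (R : Finset (Fin n))
    (l : List (Fin n)) (hl : l.Nodup) :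
    ∫ G, deviation (1 - p) k (l.filter (· ∈ R)).length (greedyPrefix G R l).card
        ∂(binomialRandom (Fin n) p) ≤
      (l.filter (· ∈ R)).length * (((1 - (p : ℝ)) ^ (k - 1))⁻¹ - 1) := by
  classical
  have hq : 0 < 1 - (p : ℝ) := by linarith
  have hq1 : 1 - (p : ℝ) ≤ 1 := by linarith [p.2.1]
  induction l using List.reverseRecOn with
  | nil => simp [deviation, expectedScans]
  | append_singleton l u ih =>
    have hl' : l.Nodup ∧ u ∉ l := by
      rw [List.nodup_append] at hl
      exact ⟨hl.1, fun h => hl.2.2 u h u (by simp) rfl⟩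
    have ih := ih hl'.1
    by_cases hu : u ∈ R
    · have hlen : (List.filter (· ∈ R) (l ++ [u])).length = (l.filter (· ∈ R)).length + 1 := by
        simp [hu]
      rw [hlen]
      set r := (l.filter (· ∈ R)).length with hr
      -- The new deviation is written as an affine function of the acceptance indicator, so that
      -- averaging needs only the probability of acceptance.
      set h : Finset (Fin n) → SimpleGraph (Fin n) → ℝ := fun a G =>
        (if ∀ w ∈ a, ¬ G.Adj w u then 1 else 0) *
          (deviation (1 - p) k (r + 1) (a.card + 1) - deviation (1 - p) k (r + 1) a.card) +
          deviation (1 - p) k (r + 1) a.card with hh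
      have hnot : ∀ G, u ∉ greedyPrefix G R l := fun G hG =>
        hl'.2 (greedyPrefix_subset G R l u hG).2
      have e1 : ∀ G, deviation (1 - p) k (r + 1) (greedyPrefix G R (l ++ [u])).card =
          h (greedyPrefix G R l) G := by
        intro G
        rw [greedyPrefix_concat]
        simp only [hu, true_and, hh]
        split_ifs with hG
        · rw [Finset.card_insert_of_notMem (hnot G)]; ring
        · ring
      have hres := integral_resample p (X := fun G => greedyPrefix G R l) (h := h)
        (S := fun _ => between {x | x ∈ l} {x | x ∈ l}) (T := fun a => between a {u}) ?_ ?_ ?_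
      · simp only [e1]
        rw [hres]
        have hpt : ∀ G, ∫ H, h (greedyPrefix G R l) H ∂(binomialRandom (Fin n) p) ≤
            deviation (1 - p) k r (greedyPrefix G R l).card +
              (((1 - (p : ℝ)) ^ (k - 1))⁻¹ - 1) := by
          intro G
          refine le_trans (le_of_eq ?_) (deviation_step hq hq1 k r _)
          rw [integral_add (integrable _ _) (integrable _ _), integral_mul_const,
            ← @real_eq_integral _ _ p (fun H => ∀ w ∈ greedyPrefix G R l, ¬ H.Adj w u) _,
            real_forall_not_adj p _ (hnot G)]
          simp
          ring
        refine (integral_mono' p hpt).trans ?_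
        rw [integral_add (integrable _ _) (integrable _ _)]
        simp
        linarith
      · intro a
        rw [Set.disjoint_left]
        rintro _ ⟨x, hx, y, hy, rfl⟩ ⟨w, hw, z, rfl, he⟩
        rcases Sym2.eq_iff.1 he with ⟨-, rfl⟩ | ⟨rfl, -⟩
        · exact hl'.2 hy
        · exact hl'.2 hx
      · intro a
        exact ((determinedBy_greedyPrefix R l).comp (· = a)).mono fun _ ⟨x, hx, y, hy, he⟩ =>
          ⟨x, hx.2, y, hy.2, he⟩
      · intro a G H hGH
        have : ∀ w ∈ a, (G.Adj w u ↔ H.Adj w u) := fun w hw =>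
          hGH s(w, u) (mem_between (Finset.mem_coe.2 hw) rfl)
        simp +contextual only [hh, this]
    · have hlen : (List.filter (· ∈ R) (l ++ [u])).length = (l.filter (· ∈ R)).length := by
        simp [hu]
      have : ∀ G, greedyPrefix G R (l ++ [u]) = greedyPrefix G R l := by
        intro G; rw [greedyPrefix_concat, if_neg (fun h => hu h.1)]
      simpa only [hlen, this] using ih

/-- The greedy independent set of the subgraph induced on `R` is unlikely to have fewer than
`log (1 + c p |R|) / (- log (1 - p))` elements. -/
lemma real_greedyIndepSet_lt_le (p : I) (hp0 : 0 < (p : ℝ)) (hp : (p : ℝ) < 1) {c : ℝ} (hc : 0 < c)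
    (hc1 : c < 1) (R : Finset (Fin n)) :
    (binomialRandom (Fin n) p).real {G | ((greedyIndepSet G R).card : ℝ) <
      Real.log (1 + c * R.card * p) / (-Real.log (1 - p))} ≤ c * p / (1 - c) ^ 2 := by
  classical
  have hq : 0 < 1 - (p : ℝ) := by linarith
  have hq1 : 1 - (p : ℝ) ≤ 1 := by linarith
  have hlam : 0 < -Real.log (1 - p) := by
    have := Real.log_neg hq (by linarith)
    linarith
  rcases Nat.eq_zero_or_pos R.card with hR | hR
  · rw [hR]
    have : 0 ≤ c * p / (1 - c) ^ 2 := by positivity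
    have hemp : {G : SimpleGraph (Fin n) | ((greedyIndepSet G R).card : ℝ) < 0} = ∅ := by
      ext G; simp
    simpa [hemp] using this
  have hR' : (0 : ℝ) < R.card := by exact_mod_cast hR
  set x := Real.log (1 + c * R.card * p) / (-Real.log (1 - p)) with hx
  have hx0 : 0 < x := div_pos (Real.log_pos (by
    have : 0 < c * R.card * p := by positivity
    linarith)) hlam
  -- Fewer than x elements means fewer than k, while k - 1 ≤ x keeps q^(-(k-1)) ≤ 1 + cp|R|. This
  -- caps the expected scans at c|R| and the second moment at cp|R|², so a failure is a deviation of
  -- at least (1 - c)|R|.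
  set k := ⌈x⌉₊ with hk
  have hk1 : 1 ≤ k := Nat.ceil_pos.2 hx0
  have hkx : ((k - 1 : ℕ) : ℝ) ≤ x := by
    have := Nat.ceil_lt_add_one hx0.le
    push_cast [hk1]
    linarith
  have hV : ((1 - (p : ℝ)) ^ (k - 1))⁻¹ ≤ 1 + c * R.card * p := by
    rw [← Real.log_le_log_iff (by positivity) (by positivity), Real.log_inv, Real.log_pow]
    rw [hx, le_div_iff₀ hlam] at hkx
    linarith
  have hscan : ∀ m < k, expectedScans (1 - p) m ≤ c * R.card := by
    intro m hm
    refine (expectedScans_mono hq (Nat.le_sub_one_of_lt hm)).trans ?_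
    have := mul_expectedScans_le hq (k - 1)
    have h2 : (p : ℝ) * expectedScans (1 - p) (k - 1) ≤ p * (c * R.card) := by
      calc (p : ℝ) * expectedScans (1 - p) (k - 1) = (1 - (1 - p)) * expectedScans (1 - p) (k - 1) := by ring
        _ ≤ _ := this
        _ ≤ _ := by linarith
    exact le_of_mul_le_mul_left h2 hp0
  have hlen : ((List.finRange n).filter (· ∈ R)).length = R.card := by
    rw [← List.toFinset_card_of_nodup ((List.nodup_finRange n).filter _)]
    congr 1
    ext; simp
  have hdev := integral_deviation_le p hp k R (List.finRange n) (List.nodup_finRange n)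
  rw [hlen] at hdev
  simp only [greedyPrefix_finRange] at hdev
  have hmain : ((1 - c) * R.card) ^ 2 * (binomialRandom (Fin n) p).real
      {G | ((greedyIndepSet G R).card : ℝ) < x} ≤ R.card * (c * R.card * p) := by
    refine le_trans ?_ (hdev.trans (mul_le_mul_of_nonneg_left (by linarith) hR'.le))
    rw [real_eq_integral, ← integral_const_mul]
    refine integral_mono' p fun G => ?_
    split_ifs with h
    · have hlt : (greedyIndepSet G R).card < k := Nat.lt_ceil.2 h
      rw [deviation, if_pos hlt, mul_one]
      have h1 : (1 - c) * R.card ≤ R.card - expectedScans (1 - p) (greedyIndepSet G R).card := by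
        linarith [hscan _ hlt]
      have h2 : 0 ≤ (1 - c) * R.card := mul_nonneg (by linarith) hR'.le
      exact pow_le_pow_left₀ h2 h1 2
    · rw [mul_zero, deviation]
      split_ifs <;> positivity
  have hc2 : 0 < (1 - c) ^ 2 := by
    have : 0 < 1 - c := by linarith
    positivity
  rw [le_div_iff₀ hc2]
  have hRR : (0 : ℝ) < (R.card : ℝ) ^ 2 := by positivity
  refine le_of_mul_le_mul_left ?_ hRR
  linarith

end RandomGraph

/-! ## The survivors of Augment-BFS induce a forest -/

namespace AugmentBFS

variable {n : ℕ} (G : SimpleGraph (Fin n))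

/-- The exposed vertices that were not deleted. -/
def survivors (s : State n) : Finset (Fin n) := s.exposed \ s.deleted

lemma mem_frontier {s : State n} {u : Fin n} :
    u ∈ frontier G s ↔ u ∉ s.exposed ∧ ∃ w ∈ s.level, G.Adj w u := by
  simp [frontier]

lemma mem_uniqueNeighbors {s : State n} {u : Fin n} :
    u ∈ uniqueNeighbors G s ↔ u ∉ s.exposed ∧ ∃! w, w ∈ s.level ∧ G.Adj w u := by
  simp only [uniqueNeighbors, Finset.mem_filter, mem_frontier]
  constructor
  · exact fun h => ⟨h.1.1, h.2⟩
  · exact fun h => ⟨⟨h.1, h.2.exists⟩, h.2⟩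

lemma uniqueNeighbors_subset (s : State n) : uniqueNeighbors G s ⊆ frontier G s := by
  intro u hu
  rw [mem_uniqueNeighbors] at hu
  exact (mem_frontier G).2 ⟨hu.1, hu.2.exists⟩

lemma level_step_subset (s : State n) : (step G s).level ⊆ frontier G s :=
  (greedyIndepSet_subset G _).trans (uniqueNeighbors_subset G s)

/-- The sets of a state are nested as they are in an exploration. -/
structure Nested (s : State n) : Prop where
  level_subset : s.level ⊆ s.exposed
  deleted_subset : s.deleted ⊆ s.exposed
  disjoint : Disjoint s.level s.deleted

lemma nested_init (v : Fin n) : Nested (init v) :=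
  ⟨subset_rfl, Finset.empty_subset _, Finset.disjoint_empty_right _⟩

lemma Nested.step {s : State n} (hs : Nested s) : Nested (step G s) := by
  have hL := level_step_subset G s
  refine ⟨hL.trans Finset.subset_union_right,
    Finset.union_subset_union hs.deleted_subset Finset.sdiff_subset, ?_⟩
  simp only [AugmentBFS.step, Finset.disjoint_union_right]
  refine ⟨?_, Finset.disjoint_sdiff⟩
  rw [Finset.disjoint_left]
  exact fun u hu hud => ((mem_frontier G).1 (hL hu)).1 (hs.deleted_subset hud)

lemma Nested.survivors_step {s : State n} (hs : Nested s) :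
    survivors (AugmentBFS.step G s) = survivors s ∪ (AugmentBFS.step G s).level := by
  have hL := level_step_subset G s
  have hK : ∀ u ∈ frontier G s, u ∉ s.exposed := fun _ hu => ((mem_frontier G).1 hu).1
  ext u
  have h1 := @hL u
  have h2 := hK u
  have h3 := @hs.deleted_subset u
  simp only [survivors, AugmentBFS.step, Finset.mem_sdiff, Finset.mem_union] at *
  tauto

lemma Nested.card_survivors_step {s : State n} (hs : Nested s) :
    (survivors (AugmentBFS.step G s)).card =
      (survivors s).card + (AugmentBFS.step G s).level.card := by
  rw [hs.survivors_step G, Finset.card_union_of_disjoint]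
  rw [Finset.disjoint_left]
  exact fun u hu hul => ((mem_frontier G).1 (level_step_subset G s hul)).1
    (Finset.mem_sdiff.1 hu).1

lemma nested_iterate (v : Fin n) (i : ℕ) : Nested ((step G)^[i] (init v)) := by
  induction i with
  | zero => exact nested_init v
  | succ i ih => rw [Function.iterate_succ_apply']; exact ih.step G

lemma card_survivors_iterate_mono (v : Fin n) {i j : ℕ} (h : i ≤ j) :
    (survivors ((step G)^[i] (init v))).card ≤ (survivors ((step G)^[j] (init v))).card := by
  induction j, h using Nat.le_induction with
  | base => exact le_rfl
  | succ j _ ih =>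
    rw [Function.iterate_succ_apply', (nested_iterate G v j).card_survivors_step G]
    omega

lemma output_eq_compl (v : Fin n) :
    output G v = Finset.univ \ survivors ((step G)^[n] (init v)) := by
  ext u
  simp only [output, survivors, Finset.mem_union, Finset.mem_sdiff, Finset.mem_univ, true_and]
  tauto

lemma card_output_add (v : Fin n) :
    (output G v).card + (survivors ((step G)^[n] (init v))).card = n := by
  rw [output_eq_compl, Finset.card_sdiff_add_card_eq_card (Finset.subset_univ _)]
  simp

/-- The survivors induce a forest, and those that are not in the current level have no unexposed
neighbours. -/
structure ForestInvariant (s : State n) : Prop where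
  nested : Nested s
  acyclic : ∀ ⦃v : Fin n⦄ (c : G.Walk v v), c.IsCycle → ∃ u ∈ c.support, u ∉ survivors s
  not_adj : ∀ w ∈ survivors s, w ∉ s.level → ∀ u ∉ s.exposed, ¬ G.Adj w u

lemma forestInvariant_init (v : Fin n) : ForestInvariant G (init v) where
  nested := nested_init v
  acyclic := by
    intro x c hc
    by_contra! h
    have h1 := h _ (c.getVert_mem_support 1)
    have h2 := h _ (c.start_mem_support)
    simp only [survivors, init, Finset.sdiff_empty, Finset.mem_singleton] at h1 h2
    exact (c.adj_snd hc.not_nil).ne (h2.trans h1.symm)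
  not_adj := by
    intro w hw hwl
    simp [survivors, init] at hw hwl
    exact absurd hw hwl

/-- A cycle through a new vertex x would leave it by two distinct neighbours. Both are survivors
adjacent to x; new vertices are pairwise non-adjacent and survivors before the last level have no
unexposed neighbours, so both lie in the last level, where x has only one neighbour. A cycle without
new vertices existed before. -/
lemma ForestInvariant.step {s : State n} (hs : ForestInvariant G s) :
    ForestInvariant G (step G s) where
  nested := hs.nested.step G
  acyclic := by
    classical
    intro v c hc
    by_contra! h
    rw [hs.nested.survivors_step G] at h
    by_cases hx : ∃ x ∈ c.support, x ∈ (AugmentBFS.step G s).level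
    · obtain ⟨x, hxc, hxL⟩ := hx
      have hxR : x ∈ uniqueNeighbors G s := greedyIndepSet_subset G _ hxL
      obtain ⟨hxE, hxu⟩ := (mem_uniqueNeighbors G).1 hxR
      have key : ∀ y ∈ c.support, G.Adj y x → y ∈ s.level ∧ G.Adj y x := by
        intro y hy hyx
        refine ⟨?_, hyx⟩
        by_contra hyl
        rcases Finset.mem_union.1 (h y hy) with h' | h'
        · exact hs.not_adj y h' hyl x hxE hyx
        · exact greedyIndepSet_indep G _ y h' x hxL hyx
      have hc' := hc.rotate hxc
      have hmem : ∀ y ∈ (c.rotate x hxc).support, y ∈ c.support := fun y hy => by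
        simpa using hy
      refine hc'.snd_ne_penultimate (hxu.unique (key _ (hmem _ ?_) ?_) (key _ (hmem _ ?_) ?_))
      · exact SimpleGraph.Walk.getVert_mem_support _ _
      · exact ((c.rotate x hxc).adj_snd hc'.not_nil).symm
      · exact SimpleGraph.Walk.getVert_mem_support _ _
      · exact (c.rotate x hxc).adj_penultimate hc'.not_nil
    · push Not at hx
      obtain ⟨u, hu, hus⟩ := hs.acyclic c hc
      rcases Finset.mem_union.1 (h u hu) with h' | h'
      · exact hus h'
      · exact hx u hu h'
  not_adj := by
    intro w hw hwl u hu hwu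
    rw [hs.nested.survivors_step G, Finset.mem_union, or_iff_left hwl] at hw
    simp only [AugmentBFS.step, Finset.mem_union, not_or, mem_frontier] at hu
    by_cases hwl' : w ∈ s.level
    · exact hu.2 ⟨hu.1, w, hwl', hwu⟩
    · exact hs.not_adj w hw hwl' u hu.1 hwu

lemma forestInvariant_iterate (v : Fin n) (i : ℕ) :
    ForestInvariant G ((step G)^[i] (init v)) := by
  induction i with
  | zero => exact forestInvariant_init G v
  | succ i ih => rw [Function.iterate_succ_apply']; exact ih.step G

theorem isFeedbackVertexSet_output (v : Fin n) : IsFeedbackVertexSet G (output G v) := by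
  intro x c hc
  obtain ⟨u, hu, hus⟩ := (forestInvariant_iterate G v n).acyclic c hc
  exact ⟨u, hu, by rw [output_eq_compl]; simpa using hus⟩

theorem isFeedbackVertexSet_compl_greedyIndepSet (R : Finset (Fin n)) :
    IsFeedbackVertexSet G (Finset.univ \ greedyIndepSet G R) := by
  intro x c hc
  by_contra! h
  simp only [Finset.mem_sdiff, Finset.mem_univ, true_and, not_not] at h
  exact greedyIndepSet_indep G R _ (h _ c.start_mem_support) _ (h _ (c.getVert_mem_support 1))
    (c.adj_snd hc.not_nil)

end AugmentBFS

/-! ## One round of Augment-BFS on the binomial random graph -/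

namespace RandomGraph

open MeasureTheory ProbabilityTheory SimpleGraph unitInterval AugmentBFS

variable {n : ℕ}

instance : Finite (State n) :=
  Finite.of_injective (fun s : State n => (s.exposed, s.deleted, s.level)) fun s t h => by
    cases s; cases t; simpa using h

/-- The pairs that decide about the next step from the state `s`. -/
def futurePairs (s : State n) : Set (Sym2 (Fin n)) :=
  between s.level {u | u ∉ s.exposed} ∪ between {u | u ∉ s.exposed} {u | u ∉ s.exposed}

/-- The pairs that have been queried when the state `s` is reached. -/
def pastPairs (s : State n) : Set (Sym2 (Fin n)) :=
  {e | (∃ a ∈ s.exposed, a ∈ e) ∧ e ∉ between (s.level : Set (Fin n)) {u | u ∉ s.exposed}}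

lemma disjoint_pastPairs_futurePairs (s : State n) : Disjoint (pastPairs s) (futurePairs s) := by
  rw [Set.disjoint_left]
  rintro e ⟨⟨a, ha, hae⟩, he⟩ (he' | ⟨x, hx, y, hy, rfl⟩)
  · exact he he'
  · rcases Sym2.mem_iff.1 hae with rfl | rfl
    · exact hx ha
    · exact hy ha

lemma uniqueNeighbors_congr {s : State n} {G H : SimpleGraph (Fin n)}
    (h : ∀ w ∈ s.level, ∀ u ∉ s.exposed, (G.Adj w u ↔ H.Adj w u)) :
    uniqueNeighbors G s = uniqueNeighbors H s := by
  ext u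
  simp only [mem_uniqueNeighbors]
  refine and_congr_right fun hu => existsUnique_congr fun w => and_congr_right fun hw => h w hw u hu

/-- Agreement is required only inside the frontier, not among all unexposed vertices: when an
earlier round is replayed from the pairs already queried, nothing more is known. -/
lemma step_congr {s : State n} {G H : SimpleGraph (Fin n)}
    (h : ∀ w ∈ s.level, ∀ u ∉ s.exposed, (G.Adj w u ↔ H.Adj w u))
    (h' : ∀ a ∈ frontier G s, ∀ b ∈ frontier G s, (G.Adj a b ↔ H.Adj a b)) :
    step G s = step H s := by
  have hK : frontier G s = frontier H s := by
    ext u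
    simp only [mem_frontier]
    exact and_congr_right fun hu => exists_congr fun w => and_congr_right fun hw => h w hw u hu
  have hR := uniqueNeighbors_congr h
  have hI : greedyIndepSet G (uniqueNeighbors G s) = greedyIndepSet H (uniqueNeighbors G s) := by
    refine determinedBy_greedyIndepSet (uniqueNeighbors G s) ?_
    rintro _ ⟨a, ha, b, hb, rfl⟩
    exact h' a (uniqueNeighbors_subset G s ha) b (uniqueNeighbors_subset G s hb)
  simp only [step, hK, ← hR, hI]

lemma determinedBy_uniqueNeighbors (s : State n) :
    DeterminedBy (between s.level {u | u ∉ s.exposed}) (fun G => uniqueNeighbors G s) :=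
  fun _ _ hGH => uniqueNeighbors_congr fun _ hw _ hu => hGH _ (mem_between hw hu)

lemma determinedBy_step (s : State n) : DeterminedBy (futurePairs s) (fun G => step G s) :=
  fun G _ hGH => step_congr (fun _ hw _ hu => hGH _ (Or.inl (mem_between hw hu)))
    fun _ ha _ hb => hGH _ (Or.inr (mem_between ((mem_frontier G).1 ha).1 ((mem_frontier G).1 hb).1))

/-- A pair that meets the exposed set of the previous state s' is in the past of s, because the new
level is disjoint from that set. Hence the history up to s' is reproduced by induction, and the last
step consults only such pairs and pairs inside the frontier, whose ends are both exposed in s. -/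
lemma iterate_step_eq_of_agree (v : Fin n) (i : ℕ) {G H : SimpleGraph (Fin n)} (s : State n)
    (hGH : ∀ e ∈ pastPairs s, e ∈ G.edgeSet ↔ e ∈ H.edgeSet) (hs : (step G)^[i] (init v) = s) :
    (step H)^[i] (init v) = s := by
  induction i generalizing s with
  | zero => exact hs
  | succ i ih =>
    rw [Function.iterate_succ_apply'] at hs ⊢
    set s' := (step G)^[i] (init v) with hs'
    have hnest : Nested s' := nested_iterate G v i
    have hE : s'.exposed ⊆ s.exposed := hs ▸ Finset.subset_union_left
    have hK : frontier G s' ⊆ s.exposed := hs ▸ Finset.subset_union_right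
    have hL : ∀ x ∈ s.level, x ∉ s'.exposed := fun x hx =>
      ((mem_frontier G).1 (level_step_subset G s' (hs ▸ hx))).1
    have hmem : ∀ a ∈ s'.exposed, ∀ e, a ∈ e → e ∈ pastPairs s := by
      rintro a ha e hae
      refine ⟨⟨a, hE ha, hae⟩, ?_⟩
      rintro ⟨x, hx, y, hy, rfl⟩
      rcases Sym2.mem_iff.1 hae with rfl | rfl
      · exact hL _ hx ha
      · exact hy (hE ha)
    rw [ih s' (fun e ⟨⟨a, ha, hae⟩, _⟩ => hGH e (hmem a ha e hae)) rfl, ← hs]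
    symm
    refine step_congr (fun w hw u _ => hGH s(w, u)
      (hmem w (hnest.level_subset hw) _ (Sym2.mem_mk_left _ _))) fun a ha b hb => hGH s(a, b)
        ⟨⟨a, hK ha, Sym2.mem_mk_left _ _⟩, ?_⟩
    rintro ⟨x, hx, y, hy, he⟩
    rcases Sym2.eq_iff.1 he with ⟨-, rfl⟩ | ⟨rfl, -⟩
    · exact hy (hK hb)
    · exact hy (hK ha)

lemma determinedBy_iterate_step (v : Fin n) (i : ℕ) (s : State n) :
    DeterminedBy (pastPairs s) (fun G => (step G)^[i] (init v) = s) := fun _ _ hGH =>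
  propext ⟨iterate_step_eq_of_agree v i s hGH,
    iterate_step_eq_of_agree v i s fun e he => (hGH e he).symm⟩

/-- If every state with property `Q` is unlikely to lose the property `Q'` in the next step, then
so is the state after `i` rounds. -/
lemma real_iterate_succ_le (p : I) (v : Fin n) (i : ℕ) {Q Q' : State n → Prop} {b : ℝ}
    (hb : 0 ≤ b) (h : ∀ s, Nested s → Q s →
      (binomialRandom (Fin n) p).real {G | ¬ Q' (step G s)} ≤ b) :
    (binomialRandom (Fin n) p).real {G | ¬ Q' ((step G)^[i + 1] (init v))} ≤
      (binomialRandom (Fin n) p).real {G | ¬ Q ((step G)^[i] (init v))} + b := by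
  classical
  -- The failure indicator is cut off at states that are not nested or lack Q, so that its mean is
  -- at most b for every state, as averaging before inserting the random state requires.
  set f : State n → SimpleGraph (Fin n) → ℝ := fun s G =>
    if Nested s ∧ Q s then (if ¬ Q' (step G s) then 1 else 0) else 0 with hf
  have hfb : ∀ s, ∫ G, f s G ∂(binomialRandom (Fin n) p) ≤ b := by
    intro s
    by_cases hs : Nested s ∧ Q s
    · simp only [hf, if_pos hs]
      rw [← real_eq_integral]
      exact h s hs.1 hs.2
    · simpa only [hf, if_neg hs, integral_zero] using hb
  have hres := integral_resample p (X := fun G => (step G)^[i] (init v)) (h := f)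
    (S := pastPairs) (T := futurePairs) disjoint_pastPairs_futurePairs
    (determinedBy_iterate_step v i) (fun s => (determinedBy_step s).comp fun t =>
      if Nested s ∧ Q s then (if ¬ Q' t then (1 : ℝ) else 0) else 0)
  have hle : ∫ G, f ((step G)^[i] (init v)) G ∂(binomialRandom (Fin n) p) ≤ b := by
    rw [hres]
    refine (integral_mono' p fun G => hfb _).trans ?_
    simp
  refine le_trans ?_ (add_le_add_right hle _)
  rw [real_eq_integral, real_eq_integral, ← integral_add (integrable _ _) (integrable _ _)]
  refine integral_mono' p fun G => ?_
  rw [Function.iterate_succ_apply']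
  have hn := nested_iterate G v i
  by_cases hQ : Q ((step G)^[i] (init v)) <;>
    by_cases hQ' : Q' (step G ((step G)^[i] (init v))) <;> simp [hf, hQ, hQ', hn]

/-! ### Concentration estimates for a single round from a fixed state. -/

section Round

variable (p : I) {s : State n}

/-- Concentration of the number of vertices that remain unexposed after one more round. -/
lemma real_unexposed_le (hs : Nested s) {δ : ℝ} (hδ : 0 < δ)
    (hpos : 0 < (1 - (p : ℝ)) ^ s.level.card * (s.exposedᶜ).card) :
    (binomialRandom (Fin n) p).real {G | (((step G s).exposedᶜ).card : ℝ) ≤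
        (1 - δ) * ((1 - (p : ℝ)) ^ s.level.card * (s.exposedᶜ).card)} ≤
      1 / (δ ^ 2 * ((1 - (p : ℝ)) ^ s.level.card * (s.exposedᶜ).card)) := by
  classical
  have e : ∀ G : SimpleGraph (Fin n), (step G s).exposedᶜ =
      (s.exposedᶜ).filter (fun u => ∀ w ∈ s.level, ¬ G.Adj w u) := by
    intro G
    ext u
    simp only [step, Finset.mem_compl, Finset.mem_union, mem_frontier, Finset.mem_filter]
    push Not
    tauto
  simp only [e]
  refine real_count_le p _ hδ hpos (T := fun u => between s.level {u}) ?_ ?_ ?_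
  · intro u _ G H hGH
    have : ∀ w ∈ s.level, (G.Adj w u ↔ H.Adj w u) := fun w hw => hGH _ (mem_between hw rfl)
    simp +contextual only [this]
  · intro x hx y hy hxy
    rw [Set.disjoint_left]
    rintro _ ⟨a, ha, b, rfl, rfl⟩ ⟨c, hc, d, rfl, he⟩
    rcases Sym2.eq_iff.1 he with ⟨-, h⟩ | ⟨rfl, -⟩
    · exact hxy h
    · exact Finset.mem_compl.1 hy (hs.level_subset ha)
  · exact fun u hu => real_forall_not_adj p _ fun h => Finset.mem_compl.1 hu (hs.level_subset h)

/-- Concentration of the number of unexposed vertices with exactly one neighbour in the level. -/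
lemma real_uniqueNeighbors_le (hs : Nested s) {δ : ℝ} (hδ : 0 < δ)
    (hpos : 0 < s.level.card * (p : ℝ) * (1 - (p : ℝ)) ^ (s.level.card - 1) * (s.exposedᶜ).card) :
    (binomialRandom (Fin n) p).real {G | ((uniqueNeighbors G s).card : ℝ) ≤
        (1 - δ) * (s.level.card * p * (1 - (p : ℝ)) ^ (s.level.card - 1) * (s.exposedᶜ).card)} ≤
      1 / (δ ^ 2 *
        (s.level.card * p * (1 - (p : ℝ)) ^ (s.level.card - 1) * (s.exposedᶜ).card)) := by
  classical
  have e : ∀ G : SimpleGraph (Fin n), uniqueNeighbors G s =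
      (s.exposedᶜ).filter (fun u => ∃! w, w ∈ s.level ∧ G.Adj w u) := by
    intro G
    ext u
    simp only [Finset.mem_compl, mem_uniqueNeighbors, Finset.mem_filter]
  simp only [e]
  refine real_count_le p _ hδ hpos (T := fun u => between s.level {u}) ?_ ?_ ?_
  · intro u _ G H hGH
    refine propext (existsUnique_congr fun w => and_congr_right fun hw => ?_)
    exact hGH _ (mem_between hw rfl)
  · intro x hx y hy hxy
    rw [Set.disjoint_left]
    rintro _ ⟨a, ha, b, rfl, rfl⟩ ⟨c, hc, d, rfl, he⟩
    rcases Sym2.eq_iff.1 he with ⟨-, h⟩ | ⟨rfl, -⟩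
    · exact hxy h
    · exact Finset.mem_compl.1 hy (hs.level_subset ha)
  · exact fun u hu => real_existsUnique_adj p _ fun h => Finset.mem_compl.1 hu (hs.level_subset h)

/-- The new level is unlikely to be small compared with the number of its candidates. -/
lemma real_level_lt_le (hs : Nested s) (hp0 : 0 < (p : ℝ)) (hp : (p : ℝ) < 1) :
    (binomialRandom (Fin n) p).real {G | ((step G s).level.card : ℝ) <
      Real.log (1 + 1 / 2 * (uniqueNeighbors G s).card * p) / (-Real.log (1 - p))} ≤ 2 * p := by
  classical
  -- Resampling needs a function determined by pairs of unexposed vertices for every R, also those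
  -- that cannot occur; intersecting with the unexposed set ensures this and changes nothing for the
  -- actual candidates.
  set f : Finset (Fin n) → SimpleGraph (Fin n) → ℝ := fun R G =>
    if ((greedyIndepSet G (R ∩ s.exposedᶜ)).card : ℝ) <
      Real.log (1 + 1 / 2 * (R ∩ s.exposedᶜ).card * p) / (-Real.log (1 - p)) then 1 else 0 with hf
  have hsub : ∀ G, uniqueNeighbors G s ∩ s.exposedᶜ = uniqueNeighbors G s := by
    intro G
    rw [Finset.inter_eq_left]
    exact fun u hu => Finset.mem_compl.2 ((mem_uniqueNeighbors G).1 hu).1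
  have hres := integral_resample p (X := fun G => uniqueNeighbors G s) (h := f)
    (S := fun _ => between s.level {u | u ∉ s.exposed})
    (T := fun _ => between {u | u ∉ s.exposed} {u | u ∉ s.exposed}) ?_
    (fun R => (determinedBy_uniqueNeighbors s).comp (· = R)) ?_
  · have e : ∀ G, (if ((step G s).level.card : ℝ) <
        Real.log (1 + 1 / 2 * (uniqueNeighbors G s).card * p) / (-Real.log (1 - p))
        then (1 : ℝ) else 0) = f (uniqueNeighbors G s) G := by
      intro G
      simp only [hf, hsub]
      rfl
    rw [real_eq_integral]
    simp only [e]
    rw [hres]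
    have : ∀ R, ∫ G, f R G ∂(binomialRandom (Fin n) p) ≤ 2 * p := by
      intro R
      simp only [hf]
      rw [← real_eq_integral]
      refine (real_greedyIndepSet_lt_le p hp0 hp (by norm_num) (by norm_num) _).trans ?_
      norm_num
      linarith
    refine (integral_mono' p fun G => this _).trans ?_
    simp
  · intro R
    rw [Set.disjoint_left]
    rintro _ ⟨a, ha, b, hb, rfl⟩ ⟨c, hc, d, hd, he⟩
    rcases Sym2.eq_iff.1 he with ⟨rfl, -⟩ | ⟨rfl, -⟩
    · exact hc (hs.level_subset ha)
    · exact hd (hs.level_subset ha)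
  · intro R
    refine ((determinedBy_greedyIndepSet (R ∩ s.exposedᶜ)).comp fun J =>
      if (J.card : ℝ) < Real.log (1 + 1 / 2 * (R ∩ s.exposedᶜ).card * p) / (-Real.log (1 - p))
      then (1 : ℝ) else 0).mono ?_
    rintro _ ⟨a, ha, b, hb, rfl⟩
    simp only [Finset.coe_inter, Finset.coe_compl, Set.mem_inter_iff, Set.mem_compl_iff,
      Finset.mem_coe] at ha hb
    exact mem_between ha.2 hb.2

end Round

end RandomGraph

/-! ## The number of survivors of Augment-BFS -/

namespace RandomGraph

open MeasureTheory ProbabilityTheory SimpleGraph unitInterval AugmentBFS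

variable {n : ℕ}

lemma neg_log_one_sub_le {p : ℝ} (hp : p < 1) : -Real.log (1 - p) ≤ p / (1 - p) := by
  have h : 0 < 1 - p := by linarith
  have := Real.one_sub_inv_le_log_of_pos h
  have e : p / (1 - p) = (1 - p)⁻¹ - 1 := by field_simp; ring
  linarith

lemma half_le_log_one_add {z : ℝ} (hz : 0 ≤ z) (hz1 : z ≤ 1) : z / 2 ≤ Real.log (1 + z) := by
  have h : 0 < 1 + z := by linarith
  have := Real.one_sub_inv_le_log_of_pos h
  have e : 1 - (1 + z)⁻¹ = z / (1 + z) := by field_simp; ring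
  have : z / 2 ≤ z / (1 + z) := div_le_div_of_nonneg_left hz h (by linarith)
  linarith

/-- The exploration either has already produced `log (np / A) / (- log (1 - p))` survivors, or its
current level is large and there are still many unexposed vertices. -/
def OnTrack (p A δ : ℝ) (i : ℕ) (s : State n) : Prop :=
  Real.log (n * p / A) ≤ -Real.log (1 - p) * (survivors s).card ∨
    (2 : ℝ) ^ i ≤ s.level.card ∧ 2 ^ i * p < 2 ∧
      (1 - p) ^ (survivors s).card * (n - 1) * (1 - δ) ^ i ≤
        (1 - p) ^ s.level.card * (s.exposedᶜ).card

lemma onTrack_init {p A δ : ℝ} (hp : p ≤ 1) (v : Fin n) : OnTrack p A δ 0 (init v) := by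
  right
  have : ((({v} : Finset (Fin n))ᶜ).card : ℝ) = n - 1 := by
    rw [Finset.card_compl]
    simp only [Fintype.card_fin, Finset.card_singleton]
    have : 1 ≤ n := Fin.pos v
    push_cast [this]
    ring
  simp only [init, survivors, Finset.sdiff_empty, Finset.card_singleton, this]
  norm_num
  linarith

section

variable {p A δ : ℝ} {i : ℕ} {s : State n}

/-- The quantities that the concentration results compare with. -/
lemma OnTrack.bounds (hp0 : 0 < p) (hp : p ≤ 1 / 2) (hA : 128 ≤ A) (hAd : A ≤ n * p)
    (hδi : i * δ ≤ 1 / 2) (hs : OnTrack p A δ i s) (hnot : -Real.log (1 - p) * (survivors s).card < Real.log (n * p / A)) :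
    (2 : ℝ) ^ i ≤ s.level.card ∧
    A / (4 * p) ≤ (1 - p) ^ s.level.card * (s.exposedᶜ).card ∧
    (1 - p) ^ (survivors s).card * n / 4 ≤ (1 - p) ^ s.level.card * (s.exposedᶜ).card ∧
    s.level.card * p * ((1 - p) ^ s.level.card * (s.exposedᶜ).card) ≤
      s.level.card * p * (1 - p) ^ (s.level.card - 1) * (s.exposedᶜ).card := by
  obtain ⟨h1, -, h3⟩ := hs.resolve_left (not_le.2 hnot)
  have hq : 0 < 1 - p := by linarith
  have hn : 2 ≤ (n : ℝ) := by
    by_contra! h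
    nlinarith
  have hA0 : 0 < A := by linarith
  -- This is the unmet target, exponentiated.
  have hqS : A / (n * p) ≤ (1 - p) ^ (survivors s).card := by
    rw [← Real.log_le_log_iff (by positivity) (by positivity), Real.log_pow]
    have : Real.log (A / (n * p)) = - Real.log (n * p / A) := by
      rw [← Real.log_inv, inv_div]
    rw [this]
    nlinarith
  -- Bernoulli's inequality. Together with n - 1 ≥ n/2 it costs a factor 4 in the invariant.
  have hpow : 1 / 2 ≤ (1 - δ) ^ i := by
    rcases Nat.eq_zero_or_pos i with rfl | hi
    · norm_num
    have hi' : (1 : ℝ) ≤ i := by exact_mod_cast hi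
    have := one_add_mul_le_pow (a := -δ) (by nlinarith) i
    rw [← sub_eq_add_neg] at this
    linarith
  have hu : (1 - p) ^ (survivors s).card * n / 4 ≤
      (1 - p) ^ s.level.card * (s.exposedᶜ).card := by
    refine le_trans ?_ h3
    have : (1 - p) ^ (survivors s).card * (n - 1) * (1 / 2) ≤
        (1 - p) ^ (survivors s).card * (n - 1) * (1 - δ) ^ i :=
      mul_le_mul_of_nonneg_left hpow (mul_nonneg (by positivity) (by linarith))
    have h0 : 0 < (1 - p) ^ (survivors s).card := by positivity
    nlinarith
  refine ⟨h1, le_trans ?_ hu, hu, ?_⟩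
  · have : A / (4 * p) = A / (n * p) * n / 4 := by field_simp
    rw [this]
    gcongr
  · have h4 : (1 - p) ^ s.level.card ≤ (1 - p) ^ (s.level.card - 1) :=
      pow_le_pow_of_le_one hq.le (by linarith) (Nat.sub_le _ _)
    calc _ = s.level.card * p * (1 - p) ^ s.level.card * (s.exposedᶜ).card := by ring
      _ ≤ _ := by gcongr

/-- The deterministic core: if the three concentration events hold, the round either finishes or at
least doubles the level. The last clause of the invariant survives because S grows by exactly the
size of the new level, so both sides gain the same power of 1 - p, and concentration costs one
factor 1 - δ. -/
lemma OnTrack.advance (G : SimpleGraph (Fin n)) (hp0 : 0 < p) (hp : p ≤ 1 / 2) (hA : 128 ≤ A)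
    (hAd : A ≤ n * p) (hδ1 : δ ≤ 1) (hδi : i * δ ≤ 1 / 2) (hnest : Nested s)
    (hs : OnTrack p A δ i s) (hnot : -Real.log (1 - p) * (survivors s).card < Real.log (n * p / A))
    (hU : (1 - δ) * ((1 - p) ^ s.level.card * (s.exposedᶜ).card) ≤
      ((step G s).exposedᶜ).card)
    (hR : (1 - 1 / 2) * (s.level.card * p * (1 - p) ^ (s.level.card - 1) * (s.exposedᶜ).card) ≤
      (uniqueNeighbors G s).card)
    (hL : Real.log (1 + 1 / 2 * (uniqueNeighbors G s).card * p) / (-Real.log (1 - p)) ≤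
      (step G s).level.card) :
    OnTrack p A δ (i + 1) (step G s) := by
  obtain ⟨h1, h2, h3, h4⟩ := hs.bounds hp0 hp hA hAd hδi hnot
  obtain ⟨-, -, h5⟩ := hs.resolve_left (not_le.2 hnot)
  have hq : 0 < 1 - p := by linarith
  have hA0 : 0 < A := by linarith
  have hlam : 0 < -Real.log (1 - p) := by
    have := Real.log_neg hq (by linarith)
    linarith
  have hlam2 : -Real.log (1 - p) ≤ 2 * p := by
    refine (neg_log_one_sub_le (by linarith)).trans ?_
    rw [div_le_iff₀ hq]
    nlinarith
  have hn : 0 < (n : ℝ) := by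
    by_contra! h
    nlinarith
  have hl : 1 ≤ (s.level.card : ℝ) := le_trans (one_le_pow₀ (by norm_num)) h1
  rw [div_le_iff₀ hlam] at hL
  have hcard := hnest.card_survivors_step G
  set l : ℝ := (s.level.card : ℝ)
  set u : ℝ := ((s.exposedᶜ).card : ℝ)
  set r : ℝ := ((uniqueNeighbors G s).card : ℝ)
  have hlp : 0 < l * p := by positivity
  have hr1 : l * p * (A / (4 * p)) ≤ 2 * r := by
    have := mul_le_mul_of_nonneg_left h2 hlp.le
    linarith
  have hr2 : l * p * ((1 - p) ^ (survivors s).card * n / 4) ≤ 2 * r := by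
    have := mul_le_mul_of_nonneg_left h3 hlp.le
    linarith
  -- Above the threshold, 1 + rp/2 is at least (np/A)(1 - p)^S, and its logarithm is exactly what S
  -- still lacks. Below it, log(1 + z) ≥ z/2 and -log(1 - p) ≤ 2p give a new level of size at least
  -- lA/64 ≥ 2l.
  by_cases hcase : 16 / A ≤ l * p
  · left
    have hz : n * p / A * (1 - p) ^ (survivors s).card ≤ 1 + 1 / 2 * r * p := by
      have h6 := mul_le_mul_of_nonneg_right hcase
        (by positivity : 0 ≤ ((1 - p) ^ (survivors s).card * n / 4) * (p / 4))
      have h7 := mul_le_mul_of_nonneg_right hr2 (by positivity : 0 ≤ p / 4)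
      have : n * p / A * (1 - p) ^ (survivors s).card =
          16 / A * ((1 - p) ^ (survivors s).card * n / 4 * (p / 4)) := by ring
      rw [this]
      linarith
    have hlog := Real.log_le_log (by positivity) hz
    rw [Real.log_mul (by positivity) (by positivity), Real.log_pow] at hlog
    rw [hcard]
    push_cast
    linarith
  · right
    push Not at hcase
    have hA1 : 16 / A ≤ 1 / 8 := by
      rw [div_le_div_iff₀ hA0 (by norm_num)]
      linarith
    have hz0 : l * p * A / 16 ≤ 1 / 2 * r * p := by
      have h7 := mul_le_mul_of_nonneg_right hr1 (by positivity : 0 ≤ p / 4)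
      have : l * p * (A / (4 * p)) * (p / 4) = l * p * A / 16 := by field_simp; ring
      linarith
    have hz1 : l * p * A / 16 ≤ 1 := by
      rw [lt_div_iff₀ hA0] at hcase
      linarith
    have hlog : l * p * A / 16 / 2 ≤ Real.log (1 + 1 / 2 * r * p) :=
      (half_le_log_one_add (by positivity) hz1).trans
        (Real.log_le_log (by positivity) (by linarith))
    have hl' : 2 * l ≤ (step G s).level.card := by
      have h8 : l * p * A / 16 / 2 ≤ (step G s).level.card * (2 * p) :=
        (hlog.trans hL).trans (by gcongr)
      have h9 : l * p * 128 ≤ l * p * A := by gcongr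
      have h10 : 2 * l * (2 * p) ≤ (step G s).level.card * (2 * p) := by linarith
      exact le_of_mul_le_mul_right h10 (by linarith)
    refine ⟨?_, ?_, ?_⟩
    · rw [pow_succ]; linarith
    · have : 2 ^ i * p ≤ l * p := by gcongr
      rw [pow_succ]
      linarith
    · rw [hcard, pow_add, pow_succ (1 - δ)]
      have h11 := mul_le_mul_of_nonneg_right h5
        (by have : 0 ≤ 1 - δ := by linarith
            positivity : 0 ≤ (1 - p) ^ (step G s).level.card * (1 - δ))
      have h12 := mul_le_mul_of_nonneg_left hU
        (by positivity : 0 ≤ (1 - p) ^ (step G s).level.card)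
      linarith

end

/-- The three error terms belong to the unexposed vertices (mean at least A/(4p)), the unique
neighbours (mean at least 2^i A/4) and the greedy set. The middle one decays geometrically in i, so
its sum over all rounds stays below 32/A. -/
lemma real_not_onTrack_step_le (p : I) {A δ : ℝ} {i : ℕ} {s : State n} (hp0 : 0 < (p : ℝ))
    (hp : (p : ℝ) ≤ 1 / 2) (hA : 128 ≤ A) (hAd : A ≤ n * p) (hδ : 0 < δ) (hδ1 : δ ≤ 1)
    (hδi : i * δ ≤ 1 / 2) (hnest : Nested s) (hs : OnTrack p A δ i s) :
    (binomialRandom (Fin n) p).real {G | ¬ OnTrack p A δ (i + 1) (step G s)} ≤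
      4 * p / δ ^ 2 + 16 / A * (1 / 2) ^ i + 2 * p := by
  have hA0 : 0 < A := by linarith
  have hq : 0 < 1 - (p : ℝ) := by linarith
  have hlam : 0 < -Real.log (1 - p) := by
    have := Real.log_neg hq (by linarith)
    linarith
  by_cases hnot : -Real.log (1 - p) * (survivors s).card < Real.log (n * p / A)
  · obtain ⟨h1, h2, h3, h4⟩ := hs.bounds hp0 hp hA hAd hδi hnot
    have hl : 0 < (s.level.card : ℝ) := lt_of_lt_of_le (by positivity) h1
    have hpos : 0 < (1 - (p : ℝ)) ^ s.level.card * (s.exposedᶜ).card :=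
      lt_of_lt_of_le (by positivity) h2
    have hM : 2 ^ i * A / 4 ≤
        s.level.card * p * (1 - (p : ℝ)) ^ (s.level.card - 1) * (s.exposedᶜ).card := by
      refine le_trans ?_ h4
      calc 2 ^ i * A / 4 = 2 ^ i * p * (A / (4 * p)) := by field_simp
        _ ≤ _ := by gcongr
    have hpos' := lt_of_lt_of_le (by positivity : 0 < 2 ^ i * A / 4) hM
    have e1 := real_unexposed_le p hnest hδ hpos
    have e2 := real_uniqueNeighbors_le p hnest (by norm_num : (0 : ℝ) < 1 / 2) hpos'
    have e3 := real_level_lt_le p hnest hp0 (by linarith)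
    have f1 : 1 / (δ ^ 2 * ((1 - (p : ℝ)) ^ s.level.card * (s.exposedᶜ).card)) ≤
        4 * p / δ ^ 2 := by
      rw [div_le_div_iff₀ (by positivity) (by positivity)]
      have : 1 ≤ 4 * p * ((1 - (p : ℝ)) ^ s.level.card * (s.exposedᶜ).card) := by
        rw [div_le_iff₀ (by positivity)] at h2
        linarith
      nlinarith [sq_nonneg δ]
    have f2 : 1 / ((1 / 2 : ℝ) ^ 2 *
        (s.level.card * p * (1 - (p : ℝ)) ^ (s.level.card - 1) * (s.exposedᶜ).card)) ≤
        16 / A * (1 / 2) ^ i := by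
      calc _ ≤ 1 / ((1 / 2 : ℝ) ^ 2 * (2 ^ i * A / 4)) := by gcongr
        _ = _ := by rw [div_pow (1 : ℝ) 2 i]; field_simp; norm_num
    refine le_trans ?_ (add_le_add (add_le_add (e1.trans f1) (e2.trans f2)) e3)
    refine le_trans ?_ (add_le_add_left (measureReal_union_le _ _) _)
    refine le_trans ?_ (measureReal_union_le _ _)
    refine measureReal_mono ?_
    intro G hG
    by_contra hc
    simp only [Set.mem_union, Set.mem_ofPred_eq, not_or, not_le, not_lt] at hc
    exact hG (hs.advance G hp0 hp hA hAd hδ1 hδi hnest hnot hc.1.1.le hc.1.2.le hc.2)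
  -- Once the target is reached it stays reached, since survivors are never lost.
  · have : {G : SimpleGraph (Fin n) | ¬ OnTrack p A δ (i + 1) (step G s)} = ∅ := by
      ext G
      simp only [Set.mem_ofPred_eq, Set.mem_empty_iff_false, iff_false, not_not]
      left
      rw [hnest.card_survivors_step G]
      push_cast
      push Not at hnot
      have : 0 ≤ -Real.log (1 - p) * ((step G s).level.card : ℝ) := by positivity
      linarith
    rw [this, measureReal_empty]
    positivity

lemma real_not_onTrack_iterate_le (p : I) {A δ : ℝ} (hp0 : 0 < (p : ℝ))
    (hp : (p : ℝ) ≤ 1 / 2) (hA : 128 ≤ A) (hAd : A ≤ n * p) (hδ : 0 < δ) (hδ1 : δ ≤ 1)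
    (v : Fin n) (i : ℕ) (hδi : i * δ ≤ 1 / 2) :
    (binomialRandom (Fin n) p).real {G | ¬ OnTrack p A δ i ((step G)^[i] (init v))} ≤
      i * (4 * p / δ ^ 2 + 2 * p) + 32 / A * (1 - (1 / 2) ^ i) := by
  have hA0 : 0 < A := by linarith
  induction i with
  | zero => simp [onTrack_init (A := A) (δ := δ) p.2.2 v]
  | succ i ih =>
    push_cast at hδi
    have hδi' : i * δ ≤ 1 / 2 := by linarith
    refine (real_iterate_succ_le p v i (Q := OnTrack p A δ i) (by positivity) fun s hnest hs =>
      real_not_onTrack_step_le p hp0 hp hA hAd hδ hδ1 hδi' hnest hs).trans ?_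
    have := ih hδi'
    push_cast
    have e : 32 / A * (1 - (1 / 2) ^ (i + 1)) =
      32 / A * (1 - (1 / 2) ^ i) + 16 / A * (1 / 2) ^ i := by ring
    rw [e]
    linarith

/-- With probability close to one, Augment-BFS has `log (np / A) / (- log (1 - p))` survivors. -/
lemma real_survivors_lt_le (p : I) {A : ℝ} (hp0 : 0 < (p : ℝ))
    (hp : (p : ℝ) ≤ 1 / 2) (hA : 128 ≤ A) (hAd : A ≤ n * p) (v : Fin n) {N : ℕ} (hN : 0 < N)
    (hNn : N ≤ n) (hNp : 2 ≤ 2 ^ N * (p : ℝ)) :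
    (binomialRandom (Fin n) p).real {G | -Real.log (1 - p) *
        (survivors ((step G)^[n] (init v))).card < Real.log (n * p / A)} ≤
      18 * N ^ 3 * p + 32 / A := by
  have hA0 : 0 < A := by linarith
  have hN' : (1 : ℝ) ≤ N := by exact_mod_cast hN
  have hlam : 0 < -Real.log (1 - p) := by
    have := Real.log_neg (by linarith : 0 < 1 - (p : ℝ)) (by linarith)
    linarith
  -- This δ is the largest with Nδ ≤ 1/2. After N rounds the second alternative of `OnTrack`
  -- contradicts 2^N p ≥ 2, so only the target remains.
  have h := real_not_onTrack_iterate_le p (δ := 1 / (2 * N)) hp0 hp hA hAd (by positivity)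
    (by rw [div_le_one (by positivity)]; linarith) v N (by field_simp; rfl)
  refine le_trans (measureReal_mono ?_) (h.trans ?_)
  · intro G hG hQ
    rcases hQ with hQ | hQ
    · have hmono : ((survivors ((step G)^[N] (init v))).card : ℝ) ≤
          (survivors ((step G)^[n] (init v))).card := by
        exact_mod_cast card_survivors_iterate_mono G v hNn
      have := mul_le_mul_of_nonneg_left hmono hlam.le
      simp only [Set.mem_ofPred_eq] at hG
      linarith
    · exact absurd hQ.2.1 (not_lt.2 hNp)
  · have e1 : (4 : ℝ) * p / (1 / (2 * N)) ^ 2 = 16 * N ^ 2 * p := by field_simp; ring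
    have e2 : 32 / A * (1 - (1 / 2) ^ N) ≤ 32 / A * 1 := by
      gcongr
      have : (0 : ℝ) < (1 / 2) ^ N := by positivity
      linarith
    have e3 : (N : ℝ) * (2 * p) ≤ 2 * N ^ 3 * p := by
      have : (N : ℝ) ≤ N ^ 3 := le_self_pow₀ hN' (by norm_num)
      nlinarith
    rw [e1]
    nlinarith

end RandomGraph

/-! ## Asymptotic guarantees -/

namespace RandomGraph

open MeasureTheory ProbabilityTheory SimpleGraph unitInterval AugmentBFS

lemma real_of_not {V : Type*} [Finite V] (p : I) {P : SimpleGraph V → Prop} {b : ℝ}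
    (h : (binomialRandom V p).real {G | ¬ P G} ≤ b) :
    1 - b ≤ (binomialRandom V p).real {G | P G} := by
  have := probReal_compl_eq_one_sub (μ := binomialRandom V p) (s := {G | P G}) .of_discrete
  have e : {G | ¬ P G} = {G | P G}ᶜ := rfl
  rw [e] at h
  linarith

lemma cube_le_two_pow {N : ℕ} (hN : 25 ≤ N) : 288 * (N + 1) ^ 3 ≤ 2 ^ N := by
  induction N, hN using Nat.le_induction with
  | base => norm_num
  | succ N hN ih =>
    rw [pow_succ 2 N]
    have : (N + 1 + 1) ^ 3 ≤ 2 * (N + 1) ^ 3 := by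
      obtain ⟨m, rfl⟩ := Nat.exists_eq_add_of_le hN
      ring_nf
      nlinarith [Nat.zero_le m, Nat.zero_le (m ^ 2), Nat.zero_le (m ^ 3)]
    omega

/-- A number of rounds that suffices to double a level until it has size `1 / x`. -/
lemma exists_rounds {x : ℝ} (hx : 0 < x) (hx1 : x * (144 * 26 ^ 3) ≤ 1) :
    ∃ N : ℕ, 0 < N ∧ 2 ≤ 2 ^ N * x ∧ 18 * N ^ 3 * x ≤ 1 / 8 ∧ N * x ≤ 1 := by
  classical
  have hex : ∃ m : ℕ, 1 < 144 * (m : ℝ) ^ 3 * x := by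
    obtain ⟨m, hm⟩ := exists_nat_gt (1 / x)
    rw [div_lt_iff₀ hx] at hm
    have hm1 : (1 : ℝ) ≤ m := by
      have : m ≠ 0 := by rintro rfl; norm_num at hm
      exact_mod_cast Nat.one_le_iff_ne_zero.2 this
    have : (m : ℝ) ≤ m ^ 3 := le_self_pow₀ hm1 (by norm_num)
    exact ⟨m, by nlinarith⟩
  -- N = m - 1 is the largest number with 144 N³ x ≤ 1. Then 144 (N + 1)³ x > 1, and the exponential
  -- 2^N ≥ 288 (N + 1)³ gives 2^N x ≥ 2; the smallness of x makes N large enough for that.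
  set m := Nat.find hex with hm
  have h1 : 1 < 144 * (m : ℝ) ^ 3 * x := Nat.find_spec hex
  have hm26 : 26 < m := by
    by_contra! h
    have : (m : ℝ) ^ 3 ≤ 26 ^ 3 := by gcongr; exact_mod_cast h
    nlinarith
  obtain ⟨N, hN⟩ : ∃ N, m = N + 1 := ⟨m - 1, by omega⟩
  have h2 : 144 * (N : ℝ) ^ 3 * x ≤ 1 := not_lt.1 (Nat.find_min hex (m := N) (by omega))
  have hN25 : 25 ≤ N := by omega
  have hN1 : (1 : ℝ) ≤ N := by exact_mod_cast (by omega : 1 ≤ N)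
  refine ⟨N, by omega, ?_, by linarith, ?_⟩
  · have h3 : (288 : ℝ) * (N + 1) ^ 3 ≤ 2 ^ N := by exact_mod_cast cube_le_two_pow hN25
    rw [hN] at h1
    push_cast at h1
    nlinarith
  · have : (N : ℝ) ≤ N ^ 3 := le_self_pow₀ hN1 (by norm_num)
    nlinarith

lemma one_sub_div_le {p : ℝ} (hp0 : 0 < p) (hp : p < 1) :
    (1 - p) / p ≤ 1 / (-Real.log (1 - p)) := by
  have hlam : 0 < -Real.log (1 - p) := by
    have := Real.log_neg (by linarith : 0 < 1 - p) (by linarith)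
    linarith
  rw [le_div_iff₀ hlam]
  have h1 := mul_le_mul_of_nonneg_left (neg_log_one_sub_le hp)
    (div_nonneg (by linarith) hp0.le : 0 ≤ (1 - p) / p)
  have : (1 - p) / p * (p / (1 - p)) = 1 := by
    have : 1 - p ≠ 0 := by linarith
    field_simp
  linarith

theorem augmentBFS_guarantee (p : ℕ → I) (hp : Tendsto (fun n => (p n : ℝ)) atTop (𝓝 0))
    (hnp : Tendsto (fun n : ℕ => (n : ℝ) * (p n : ℝ)) atTop atTop) :
    ∃ η : ℕ → ℝ, Tendsto η atTop (𝓝 0) ∧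
      ∀ᶠ n : ℕ in atTop, ∀ v : Fin n,
        3 / 4 ≤ (binomialRandom (Fin n) (p n)).real
          {G | ((AugmentBFS.output G v).card : ℝ) ≤
            (n : ℝ) - 1 / (p n : ℝ) * Real.log ((n : ℝ) * (p n : ℝ)) * (1 - η n)} := by
  have hlog : Tendsto (fun n : ℕ => √(Real.log (n * p n))) atTop atTop :=
    Real.tendsto_sqrt_atTop.comp (Real.tendsto_log_atTop.comp hnp)
  have hA : Tendsto (fun n : ℕ => Real.exp √(Real.log (n * p n))) atTop atTop :=
    Real.tendsto_exp_atTop.comp hlog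
  -- The factor 1 - p pays for replacing -log(1 - p) by p/(1 - p); the factor 1 - 1/√(log np) pays
  -- for log A, where A = exp √(log np).
  refine ⟨fun n => 1 - (1 - p n) * (1 - (√(Real.log (n * p n)))⁻¹), ?_, ?_⟩
  · have := ((tendsto_const_nhds (x := (1 : ℝ))).sub hp).mul
      ((tendsto_const_nhds (x := (1 : ℝ))).sub (tendsto_inv_atTop_zero.comp hlog))
    simpa using (tendsto_const_nhds (x := (1 : ℝ))).sub this
  · filter_upwards [hp.eventually_lt_const (by norm_num : (0 : ℝ) < 1 / (144 * 26 ^ 3)),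
      hA.eventually_ge_atTop 256, hlog.eventually_ge_atTop 1, hnp.eventually_ge_atTop 1]
      with n hpn hAn hln hdn v
    have hn : 0 < (n : ℝ) := by exact_mod_cast Fin.pos v
    have hp0 : 0 < (p n : ℝ) := by
      by_contra! h
      nlinarith
    rw [lt_div_iff₀ (by norm_num)] at hpn
    obtain ⟨N, hN, hNp, hN3, hNn⟩ := exists_rounds hp0 hpn.le
    have hphalf : (p n : ℝ) ≤ 1 / 2 := by linarith
    set l := Real.log (n * p n) with hl
    have hl1 : 1 ≤ l := by
      by_contra! h
      have := (Real.sqrt_lt' one_pos).2 (by simpa using h)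
      linarith
    have hsq : √l ^ 2 = l := Real.sq_sqrt (by linarith)
    have hAd : Real.exp √l ≤ n * p n := by
      rw [← Real.exp_log (by linarith : 0 < n * (p n : ℝ)), ← hl]
      exact Real.exp_le_exp.2 (by nlinarith)
    have hNn' : N ≤ n := by
      have : (N : ℝ) * p n ≤ n * p n := hNn.trans hdn
      exact_mod_cast le_of_mul_le_mul_right this hp0
    have hbound := real_survivors_lt_le (p n) hp0 hphalf (by linarith) hAd v hN hNn' hNp
    have h32 : 32 / Real.exp √l ≤ 1 / 8 := by
      rw [div_le_div_iff₀ (Real.exp_pos _) (by norm_num)]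
      linarith
    have hfin := real_of_not (p n) (P := fun G => ¬ (-Real.log (1 - p n) *
      (survivors ((step G)^[n] (init v))).card < Real.log (n * p n / Real.exp √l)))
      (by simpa only [not_not] using hbound)
    refine le_trans (by linarith) (hfin.trans (measureReal_mono ?_))
    intro G hG
    simp only [Set.mem_ofPred_eq, not_lt] at hG ⊢
    have hcard : ((output G v).card : ℝ) + (survivors ((step G)^[n] (init v))).card = n := by
      exact_mod_cast card_output_add G v
    set S : ℝ := ((survivors ((step G)^[n] (init v))).card : ℝ)
    rw [Real.log_div (by positivity) (Real.exp_pos _).ne', Real.log_exp, ← hl] at hG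
    have hlam : 0 < -Real.log (1 - p n) := by
      have := Real.log_neg (by linarith : 0 < 1 - (p n : ℝ)) (by linarith)
      linarith
    have hS : (l - √l) * (1 / -Real.log (1 - p n)) ≤ S := by
      rw [mul_one_div, div_le_iff₀ hlam]
      linarith
    have hln0 : 0 ≤ l - √l := by nlinarith
    have h5 := mul_le_mul_of_nonneg_left (one_sub_div_le hp0 (by linarith : (p n : ℝ) < 1)) hln0
    have e : 1 / (p n : ℝ) * l * (1 - (1 - (1 - p n) * (1 - (√l)⁻¹))) =
        (l - √l) * ((1 - p n) / p n) := by
      have : l * (√l)⁻¹ = √l := by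
        nth_rewrite 1 [← hsq]
        field_simp
      calc _ = (l - l * (√l)⁻¹) * ((1 - p n) / p n) := by ring
        _ = _ := by rw [this]
    rw [e]
    linarith

/-- If ds ≤ 1, the summand 1 makes up for the lost sd. If ds > 1, then log d > -log s, so the
relative loss on the left is at least log 2, which covers 1 - s ≥ 1/2. The loss depends on s alone,
so np need not tend to infinity. -/
lemma log_mul_le_log_one_add {s d : ℝ} (hs0 : 0 < s) (hs : s ≤ 1 / 2) (hd : 1 ≤ d) :
    (1 + Real.log 2 / Real.log s) * Real.log d ≤ Real.log (1 + (1 - s) * d) := by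
  have hlogs : Real.log s < 0 := Real.log_neg hs0 (by linarith)
  have hlog2 : 0 < Real.log 2 := Real.log_pos (by norm_num)
  have hlogd : 0 ≤ Real.log d := Real.log_nonneg hd
  by_cases h : d * s ≤ 1
  · have h1 : Real.log d ≤ Real.log (1 + (1 - s) * d) :=
      Real.log_le_log (by linarith) (by nlinarith)
    have h2 : Real.log 2 / Real.log s ≤ 0 := div_nonpos_of_nonneg_of_nonpos hlog2.le hlogs.le
    nlinarith
  · push Not at h
    have h1 : 0 < Real.log d + Real.log s := by
      rw [← Real.log_mul (by linarith) hs0.ne']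
      exact Real.log_pos h
    have h2 : Real.log 2 / Real.log s * Real.log d ≤ -Real.log 2 := by
      rw [div_mul_eq_mul_div, div_le_iff_of_neg hlogs]
      nlinarith
    have h3 : Real.log d - Real.log 2 ≤ Real.log (1 + (1 - s) * d) := by
      rw [← Real.log_div (by linarith) (by norm_num)]
      exact Real.log_le_log (by positivity) (by nlinarith)
    linarith

theorem greedyIndepSet_guarantee (p : ℕ → I) (hp : Tendsto (fun n => (p n : ℝ)) atTop (𝓝 0)) :
    ∃ η : ℕ → ℝ, Tendsto η atTop (𝓝 0) ∧
      ∀ᶠ n : ℕ in atTop,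
        3 / 4 ≤ (binomialRandom (Fin n) (p n)).real
          {G | ((Finset.univ \ greedyIndepSet G Finset.univ).card : ℝ) ≤
            (n : ℝ) - 1 / (p n : ℝ) * Real.log ((n : ℝ) * (p n : ℝ)) * (1 - η n)} := by
  have hs : Tendsto (fun n => √√(p n : ℝ)) atTop (𝓝 0) := by
    have h0 : Tendsto Real.sqrt (𝓝 0) (𝓝 0) := by simpa using Real.continuous_sqrt.tendsto 0
    exact h0.comp (h0.comp hp)
  -- The limit is over the full neighbourhood of 0, because p(n) = 0 is allowed; the conventions log
  -- 0 = 0 and 0⁻¹ = 0 supply the value there.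
  have hinv : Tendsto (fun x => (Real.log x)⁻¹) (𝓝 0) (𝓝 0) := by
    have h0 : Tendsto (fun x => (Real.log x)⁻¹) (pure 0) (𝓝 (Real.log 0)⁻¹) :=
      tendsto_pure_nhds (fun x : ℝ => (Real.log x)⁻¹) 0
    rw [Real.log_zero, inv_zero] at h0
    have h1 := (tendsto_inv_atBot_zero.comp Real.tendsto_log_nhdsNE_zero).sup h0
    rwa [nhdsNE_sup_pure] at h1
  refine ⟨fun n => 1 - (1 - p n) * (1 + Real.log 2 / Real.log √√(p n : ℝ)), ?_, ?_⟩
  · have := ((tendsto_const_nhds (x := (1 : ℝ))).sub hp).mul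
      ((tendsto_const_nhds (x := (1 : ℝ))).add ((hinv.comp hs).const_mul (Real.log 2)))
    simpa [div_eq_mul_inv] using (tendsto_const_nhds (x := (1 : ℝ))).sub this
  · filter_upwards [hp.eventually_lt_const (by norm_num : (0 : ℝ) < 1 / 16),
      hs.eventually_lt_const (by norm_num : (0 : ℝ) < 1 / 2)] with n hpn hsn
    have hcard : ∀ G : SimpleGraph (Fin n),
        ((Finset.univ \ greedyIndepSet G Finset.univ).card : ℝ) +
          (greedyIndepSet G Finset.univ).card = n := by
      intro G
      have := Finset.card_sdiff_add_card_eq_card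
        (Finset.subset_univ (greedyIndepSet G Finset.univ))
      simp only [Finset.card_univ, Fintype.card_fin] at this
      exact_mod_cast this
    rcases (p n).2.1.eq_or_lt with hp0 | hp0
    · have : {G : SimpleGraph (Fin n) | ((Finset.univ \ greedyIndepSet G Finset.univ).card : ℝ) ≤
          (n : ℝ) - 1 / (p n : ℝ) * Real.log ((n : ℝ) * (p n : ℝ)) *
            (1 - (1 - (1 - p n) * (1 + Real.log 2 / Real.log √√(p n : ℝ))))} = Set.univ := by
        ext G
        rw [← hp0]
        simp only [Set.mem_ofPred_eq, Set.mem_univ, iff_true]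
        have := hcard G
        have h0 : (0 : ℝ) ≤ (greedyIndepSet G Finset.univ).card := by positivity
        rw [div_zero, zero_mul, zero_mul, sub_zero]
        linarith
      rw [this, probReal_univ]
      norm_num
    · set s := √√(p n : ℝ) with hsdef
      have hs0 : 0 < s := Real.sqrt_pos.2 (Real.sqrt_pos.2 hp0)
      have hs2 : s ^ 2 = √(p n : ℝ) := Real.sq_sqrt (Real.sqrt_nonneg _)
      have hs4 : (p n : ℝ) = s ^ 2 * s ^ 2 := by
        rw [hs2, Real.mul_self_sqrt hp0.le]
      have hbound := real_greedyIndepSet_lt_le (p n) hp0 (by linarith)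
        (by linarith : 0 < 1 - s) (by linarith) (Finset.univ : Finset (Fin n))
      -- With c = 1 - s and s = p^(1/4), the failure probability is at most p/s² = √p, although c
      -- tends to 1.
      have hsmall : (1 - s) * p n / (1 - (1 - s)) ^ 2 ≤ 1 / 4 := by
        rw [sub_sub_cancel, div_le_iff₀ (by positivity), hs4]
        have : s ^ 2 ≤ 1 / 4 := by nlinarith
        have h2 : 0 < s ^ 2 := by positivity
        nlinarith
      have hfin := real_of_not (p n) (P := fun G => ¬ (((greedyIndepSet G Finset.univ).card : ℝ) <
        Real.log (1 + (1 - s) * (Finset.univ : Finset (Fin n)).card * p n) /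
          (-Real.log (1 - p n)))) (by simpa only [not_not] using hbound.trans hsmall)
      refine le_trans (by norm_num) (hfin.trans (measureReal_mono ?_))
      intro G hG
      simp only [Set.mem_ofPred_eq, not_lt, Finset.card_univ, Fintype.card_fin] at hG ⊢
      have hG' := hcard G
      set S : ℝ := ((greedyIndepSet G Finset.univ).card : ℝ)
      have hS0 : 0 ≤ S := Nat.cast_nonneg _
      suffices 1 / (p n : ℝ) * Real.log (n * p n) *
          (1 - (1 - (1 - p n) * (1 + Real.log 2 / Real.log s))) ≤ S by linarith
      have hlogs : Real.log s < 0 := Real.log_neg hs0 (by linarith)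
      have hθ : 0 ≤ 1 + Real.log 2 / Real.log s := by
        have h1 : Real.log s ≤ -Real.log 2 := by
          rw [← Real.log_inv]
          exact Real.log_le_log hs0 (by norm_num; linarith)
        have : -1 ≤ Real.log 2 / Real.log s := by
          rw [le_div_iff_of_neg hlogs]
          linarith
        linarith
      have e : 1 / (p n : ℝ) * Real.log (n * p n) *
          (1 - (1 - (1 - p n) * (1 + Real.log 2 / Real.log s))) =
          ((1 + Real.log 2 / Real.log s) * Real.log (n * p n)) * ((1 - p n) / p n) := by ring
      rw [e]
      have hpp : 0 ≤ (1 - (p n : ℝ)) / p n := div_nonneg (by linarith) hp0.le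
      by_cases hd : 1 ≤ n * (p n : ℝ)
      · refine le_trans ?_ hG
        have h1 := log_mul_le_log_one_add hs0 hsn.le hd
        have h0 : 0 ≤ Real.log (1 + (1 - s) * (n * p n)) := Real.log_nonneg (by
          have : 0 ≤ (1 - s) * (n * p n) := mul_nonneg (by linarith) (by linarith)
          linarith)
        calc _ ≤ Real.log (1 + (1 - s) * (n * p n)) * ((1 - p n) / p n) := by gcongr
          _ ≤ Real.log (1 + (1 - s) * (n * p n)) * (1 / (-Real.log (1 - p n))) :=
            mul_le_mul_of_nonneg_left (one_sub_div_le hp0 (by linarith)) h0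
          _ = _ := by rw [mul_one_div, mul_assoc (1 - s)]
      · push Not at hd
        refine le_trans ?_ hS0
        have : Real.log (n * p n) ≤ 0 := Real.log_nonpos (by positivity) hd.le
        exact mul_nonpos_of_nonpos_of_nonneg (mul_nonpos_of_nonneg_of_nonpos hθ this) hpp

end RandomGraph

/-! ## Polynomial-time programs -/

namespace RAM

variable {n : ℕ} (G : SimpleGraph (Fin n))

/-- The program `c` halts from the memory `m` after at most `T` steps, with a memory that
satisfies `Q`. -/
def Runs (c : Program) (m : Memory) (T : ℕ) (Q : Memory → Prop) : Prop :=
  ∃ t m', Exec G c m t m' ∧ t ≤ T ∧ Q m'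

variable {G}

lemma Runs.mono {c : Program} {m : Memory} {T T' : ℕ} {Q Q' : Memory → Prop}
    (h : Runs G c m T Q) (hT : T ≤ T') (hQ : ∀ m', Q m' → Q' m') : Runs G c m T' Q' := by
  obtain ⟨t, m', he, ht, hq⟩ := h
  exact ⟨t, m', he, ht.trans hT, hQ m' hq⟩

lemma runs_skip {m : Memory} {Q : Memory → Prop} (h : Q m) : Runs G .skip m 1 Q :=
  ⟨1, m, .skip m, le_rfl, h⟩

lemma runs_const {x k : ℕ} {m : Memory} {Q : Memory → Prop} (h : Q (m.setVar x k)) :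
    Runs G (.const x k) m 1 Q := ⟨1, _, .const x k m, le_rfl, h⟩

lemma runs_succ {x : ℕ} {m : Memory} {Q : Memory → Prop} (h : Q (m.setVar x (m.var x + 1))) :
    Runs G (.succ x) m 1 Q := ⟨1, _, .succ x m, le_rfl, h⟩

lemma runs_read {x a i : ℕ} {m : Memory} {Q : Memory → Prop}
    (h : Q (m.setVar x (m.arr a (m.var i)))) :
    Runs G (.read x a i) m 1 Q := ⟨1, _, .read x a i m, le_rfl, h⟩

lemma runs_write {a i x : ℕ} {m : Memory} {Q : Memory → Prop}
    (h : Q (m.setArr a (m.var i) (m.var x))) :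
    Runs G (.write a i x) m 1 Q := ⟨1, _, .write a i x m, le_rfl, h⟩

lemma runs_adj {x i j : ℕ} {m : Memory} {Q : Memory → Prop}
    (h : Q (m.setVar x (adjEntry G (m.var i) (m.var j)))) :
    Runs G (.adj x i j) m 1 Q := ⟨1, _, .adj x i j m, le_rfl, h⟩

lemma runs_seq {c d : Program} {m : Memory} {T T' : ℕ} {Q : Memory → Prop}
    (h : Runs G c m T (fun m' => Runs G d m' T' Q)) : Runs G (.seq c d) m (T + T') Q := by
  obtain ⟨t, m', he, ht, t', m'', he', ht', hq⟩ := h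
  exact ⟨t + t', m'', .seq he he', by omega, hq⟩

lemma runs_ite {x y : ℕ} {c d : Program} {m : Memory} {T T' : ℕ} {Q : Memory → Prop}
    (hc : m.var x < m.var y → Runs G c m T Q) (hd : ¬ m.var x < m.var y → Runs G d m T' Q) :
    Runs G (.ite x y c d) m (T + T' + 1) Q := by
  by_cases h : m.var x < m.var y
  · obtain ⟨t, m', he, ht, hq⟩ := hc h
    exact ⟨t + 1, m', .ite_true h he, by omega, hq⟩
  · obtain ⟨t, m', he, ht, hq⟩ := hd h
    exact ⟨t + 1, m', .ite_false h he, by omega, hq⟩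

/-- Run `c` for the values `0, …, n - 1` of the variable `i`, where `n` is held by variable `0`. -/
def forLoop (i : ℕ) (c : Program) : Program :=
  .seq (.const i 0) (.while i 0 (.seq c (.succ i)))

-- The induction is on the number k of remaining iterations. The body must leave the counter at j,
-- and the invariant for j + 1 is demanded after the increment.
lemma runs_while {i N T : ℕ} {c : Program} {Q : Memory → Prop} {J : ℕ → Memory → Prop}
    (hstep : ∀ j < N, ∀ m, m.var i = j → m.var 0 = N → J j m →
      Runs G c m T (fun m' => m'.var i = j ∧ m'.var 0 = N ∧ J (j + 1) (m'.setVar i (j + 1))))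
    (hi : i ≠ 0) (hQ : ∀ m, m.var 0 = N → J N m → Q m) :
    ∀ k j, j + k = N → ∀ m, m.var i = j → m.var 0 = N → J j m →
      Runs G (.while i 0 (.seq c (.succ i))) m (k * (T + 2) + 1) Q := by
  intro k
  induction k with
  | zero =>
    rintro j rfl m hmi hm0 hJ
    exact ⟨1, m, .while_false (by omega), by omega, hQ m hm0 hJ⟩
  | succ k ih =>
    rintro j hjk m hmi hm0 hJ
    obtain ⟨t, m', he, ht, hi', h0', hJ'⟩ := hstep j (by omega) m hmi hm0 hJ
    obtain ⟨t', m'', he', ht', hq⟩ := ih (j + 1) (by omega) (m'.setVar i (j + 1))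
      (by simp [Memory.setVar]) (by simp [Memory.setVar, Function.update_of_ne hi.symm, h0']) hJ'
    refine ⟨(t + 1) + t' + 1, m'', .while_true (by omega) (.seq he ?_) he', ?_, hq⟩
    · rw [← hi']
      exact .succ i m'
    · rw [add_mul]
      omega

lemma runs_forLoop {i N T : ℕ} {c : Program} {m : Memory} {Q : Memory → Prop}
    (J : ℕ → Memory → Prop) (hi : i ≠ 0) (hN : m.var 0 = N) (h0 : J 0 (m.setVar i 0))
    (hstep : ∀ j < N, ∀ m, m.var i = j → m.var 0 = N → J j m →
      Runs G c m T (fun m' => m'.var i = j ∧ m'.var 0 = N ∧ J (j + 1) (m'.setVar i (j + 1))))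
    (hQ : ∀ m, m.var 0 = N → J N m → Q m) :
    Runs G (forLoop i c) m (N * (T + 2) + 2) Q := by
  refine (runs_seq (runs_const (runs_while hstep hi hQ N 0 (by omega) _ ?_ ?_ h0))).mono
    (by omega) fun _ h => h
  · simp [Memory.setVar]
  · simp [Memory.setVar, Function.update_of_ne hi.symm, hN]

@[simp] lemma setVar_arr (m : Memory) (x k : ℕ) : (m.setVar x k).arr = m.arr := rfl

@[simp] lemma setArr_var (m : Memory) (a i k : ℕ) : (m.setArr a i k).var = m.var := rfl

lemma setVar_var (m : Memory) (x k y : ℕ) :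
    (m.setVar x k).var y = if y = x then k else m.var y := by
  simp [Memory.setVar, Function.update_apply]

lemma setArr_arr (m : Memory) (a i k b j : ℕ) :
    (m.setArr a i k).arr b j = if b = a ∧ j = i then k else m.arr b j := by
  by_cases hb : b = a
  · subst hb
    simp [Memory.setArr, Function.update_apply]
  · simp [Memory.setArr, hb]

lemma setArr_arr_of_ne (m : Memory) (a i k : ℕ) {b : ℕ} (h : b ≠ a) :
    (m.setArr a i k).arr b = m.arr b := by
  simp [Memory.setArr, h]

lemma adjEntry_fin (u w : Fin n) [Decidable (G.Adj u w)] :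
    adjEntry G u w = if G.Adj u w then 1 else 0 := by
  simp only [adjEntry]
  have : (∃ u' w' : Fin n, (u' : ℕ) = u ∧ (w' : ℕ) = w ∧ G.Adj u' w') ↔ G.Adj u w := by
    constructor
    · rintro ⟨u', w', hu, hw, h⟩
      rwa [Fin.ext hu, Fin.ext hw] at h
    · exact fun h => ⟨u, w, rfl, rfl, h⟩
  simp only [this]

/-- The array entries `f` mark the elements of `S` by `1` and all other vertices by `0`. -/
def Marks (f : ℕ → ℕ) (S : Finset (Fin n)) : Prop := ∀ u : Fin n, f u = if u ∈ S then 1 else 0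

/-- Variable `0` holds the number of vertices, and variables `2` and `3` hold the constants `0`
and `1`. -/
def HasConstants (n : ℕ) (m : Memory) : Prop := m.var 0 = n ∧ m.var 2 = 0 ∧ m.var 3 = 1

open Classical in
/-- The neighbours of `u` in `S`. -/
noncomputable def nbrsIn (G : SimpleGraph (Fin n)) (S : Finset (Fin n)) (u : Fin n) :
    Finset (Fin n) := S.filter (fun w => G.Adj w u)

lemma mem_nbrsIn {S : Finset (Fin n)} {u w : Fin n} :
    w ∈ nbrsIn G S u ↔ w ∈ S ∧ G.Adj w u := by
  simp [nbrsIn]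

/-- Count in variable `7` the neighbours of vertex number `var 5` that are marked in array `a`. -/
def countNbrs (a : ℕ) : Program :=
  .seq (.const 7 0) (forLoop 4 (.seq (.read 6 a 4)
    (.ite 2 6 (.seq (.adj 6 4 5) (.ite 2 6 (.succ 7) .skip)) .skip)))

lemma zero_lt_ite_iff {P : Prop} [Decidable P] : (0 < if P then 1 else 0) ↔ P := by
  split_ifs with h <;> simp [h]

/-- The elements of `S` with number less than `j`. -/
def below (S : Finset (Fin n)) (j : ℕ) : Finset (Fin n) := S.filter (fun x : Fin n => (x : ℕ) < j)

lemma mem_below {S : Finset (Fin n)} {j : ℕ} {x : Fin n} :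
    x ∈ below S j ↔ x ∈ S ∧ (x : ℕ) < j := Finset.mem_filter

@[simp] lemma below_zero (S : Finset (Fin n)) : below S 0 = ∅ := by
  ext; simp [mem_below]

@[simp] lemma below_card (S : Finset (Fin n)) : below S n = S := by
  ext; simp [mem_below]

lemma below_succ (S : Finset (Fin n)) {j : ℕ} (hj : j < n) :
    below S (j + 1) = if ⟨j, hj⟩ ∈ S then insert ⟨j, hj⟩ (below S j) else below S j := by
  ext x
  have hx : x = ⟨j, hj⟩ ↔ (x : ℕ) = j := by simp [Fin.ext_iff]
  split_ifs with h
  · rw [mem_below, Finset.mem_insert, mem_below, hx]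
    by_cases hxj : (x : ℕ) = j
    · rw [hx.2 hxj]
      simp [h]
    · have : (x : ℕ) < j + 1 ↔ (x : ℕ) < j := by omega
      simp [hxj, this]
  · rw [mem_below, mem_below]
    refine and_congr_right fun hxS => ?_
    have : (x : ℕ) ≠ j := fun h' => h (hx.2 h' ▸ hxS)
    omega

lemma card_below_succ (S : Finset (Fin n)) {j : ℕ} (hj : j < n) :
    (below S (j + 1)).card = (below S j).card + if ⟨j, hj⟩ ∈ S then 1 else 0 := by
  rw [below_succ S hj]
  split_ifs
  · rw [Finset.card_insert_of_notMem (by simp [mem_below])]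
  · rw [add_zero]

lemma runs_countNbrs {a : ℕ} {m : Memory} {S : Finset (Fin n)} {u : Fin n}
    (hc : HasConstants n m) (hu : m.var 5 = u) (hS : Marks (m.arr a) S) :
    Runs G (countNbrs a) m (9 * n + 3) (fun m' => HasConstants n m' ∧ m'.var 5 = u ∧
      m'.var 8 = m.var 8 ∧ m'.arr = m.arr ∧ m'.var 7 = (nbrsIn G S u).card) := by
  classical
  refine (runs_seq (runs_const (runs_forLoop (N := n) (T := 7) (fun j m' => HasConstants n m' ∧
    m'.var 5 = u ∧ m'.var 8 = m.var 8 ∧ m'.arr = m.arr ∧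
    m'.var 7 = (below (nbrsIn G S u) j).card) (by norm_num) ?_ ?_ ?_ ?_))).mono
    (by omega) fun _ h => h
  · simpa [setVar_var] using hc.1
  · simpa [setVar_var, HasConstants, hu] using hc
  · rintro j hj m' h4 h0 ⟨hc', hu', h8, harr, h7⟩
    obtain ⟨-, h2, h3⟩ := hc'
    have hSj := hS ⟨j, hj⟩
    have hadj := adjEntry_fin (G := G) ⟨j, hj⟩ u
    have hcard := card_below_succ (nbrsIn G S u) hj
    simp only [mem_nbrsIn] at hcard hSj hadj
    refine (runs_seq (runs_read (runs_ite (T := 4) (T' := 1) (fun h => ?_) fun h => ?_))).mono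
      (by omega) fun _ h => h
    · simp [setVar_var, harr, h4, h2, hSj, zero_lt_ite_iff] at h
      refine runs_seq (runs_adj (runs_ite (T := 1) (T' := 1) (fun h' => runs_succ ?_)
        fun h' => runs_skip ?_))
      · simp [setVar_var, h4, hu', hadj, h2, zero_lt_ite_iff] at h'
        simp [setVar_var, HasConstants, h0, h2, h3, h4, hu', h8, harr, h7, hcard, h, h']
      · simp [setVar_var, h4, hu', hadj, h2] at h'
        simp [setVar_var, HasConstants, h0, h2, h3, h4, hu', h8, harr, h7, hcard, h']
    · simp [setVar_var, harr, h4, h2, hSj] at h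
      refine runs_skip ?_
      simp [setVar_var, HasConstants, h0, h2, h3, h4, hu', h8, harr, h7, hcard, h]
  · rintro m' h0 ⟨hc', hu', h8, harr, h7⟩
    exact ⟨hc', hu', h8, harr, by rw [h7, below_card]⟩

end RAM

/-! ### Subroutines: counting neighbours, greedy selection, moving to the next level. -/

namespace RAM

open AugmentBFS

variable {n : ℕ} {G : SimpleGraph (Fin n)}

/-- For each vertex, store in array `3` the number of its neighbours that are marked in array `2`,
or `0` if the vertex itself is marked in array `1`. -/
def countFresh : Program :=
  forLoop 5 (.seq (.read 6 1 5) (.seq (.ite 2 6 (.const 7 0) (countNbrs 2)) (.write 3 5 7)))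

/-- Since exposed vertices get 0, one array encodes both sets of a round: a positive entry means
membership in the frontier, and the entry 1 means a unique neighbour. -/
lemma runs_countFresh {m : Memory} {E L : Finset (Fin n)} (hc : HasConstants n m)
    (hE : Marks (m.arr 1) E) (hL : Marks (m.arr 2) L) :
    Runs G countFresh m (n * (9 * n + 9) + 2) (fun m' => HasConstants n m' ∧
      m'.var 8 = m.var 8 ∧ (∀ a, a ≠ 3 → m'.arr a = m.arr a) ∧
      ∀ u : Fin n, m'.arr 3 u = if u ∈ E then 0 else (nbrsIn G L u).card) := by
  refine (runs_forLoop (N := n) (T := 9 * n + 7) (fun j m' => HasConstants n m' ∧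
      m'.var 8 = m.var 8 ∧ (∀ a, a ≠ 3 → m'.arr a = m.arr a) ∧
      ∀ u : Fin n, (u : ℕ) < j → m'.arr 3 u = if u ∈ E then 0 else (nbrsIn G L u).card)
      (by norm_num) hc.1 ?_ ?_ ?_)
  · simpa [setVar_var, HasConstants] using hc
  · rintro j hj m' h5 h0 ⟨⟨-, h2, h3⟩, h8, harr, hcnt⟩
    have hEj := hE ⟨j, hj⟩
    have h1 : m'.arr 1 = m.arr 1 := harr 1 (by norm_num)
    simp only at hEj
    have hfinish : ∀ m'' : Memory, HasConstants n m'' → m''.var 5 = j → m''.var 8 = m.var 8 →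
        m''.arr = m'.arr →
        m''.var 7 = (if ⟨j, hj⟩ ∈ E then 0 else (nbrsIn G L ⟨j, hj⟩).card) →
        Runs G (.write 3 5 7) m'' 1 (fun m' => m'.var 5 = j ∧ m'.var 0 = n ∧
          HasConstants n (m'.setVar 5 (j + 1)) ∧ (m'.setVar 5 (j + 1)).var 8 = m.var 8 ∧
          (∀ a, a ≠ 3 → (m'.setVar 5 (j + 1)).arr a = m.arr a) ∧
          ∀ u : Fin n, (u : ℕ) < j + 1 →
            (m'.setVar 5 (j + 1)).arr 3 u = if u ∈ E then 0 else (nbrsIn G L u).card) := by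
      intro m'' hc'' h5'' h8'' harr'' h7''
      refine runs_write ⟨h5'', hc''.1, ?_, ?_, ?_, ?_⟩
      · simpa [setVar_var, HasConstants] using hc''
      · simpa [setVar_var] using h8''
      · intro a ha
        rw [setVar_arr, setArr_arr_of_ne _ _ _ _ ha, harr'', harr a ha]
      · intro u hu
        rw [setVar_arr, setArr_arr, h5'', h7'', harr'']
        by_cases huj : (u : ℕ) = j
        · have : u = ⟨j, hj⟩ := Fin.ext huj
          subst this
          simp
        · simpa [huj] using hcnt u (by omega)
    refine (runs_seq (runs_read (runs_seq (T := 9 * n + 5) (T' := 1)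
      ((runs_ite (T := 1) (T' := 9 * n + 3) (fun h => runs_const ?_) fun h => ?_).mono
        (by omega) fun _ h => h)))).mono (by omega) fun _ h => h
    · simp [setVar_var, h5, h2, h1, hEj, zero_lt_ite_iff] at h
      refine hfinish _ ?_ ?_ ?_ ?_ ?_
      · simp [setVar_var, HasConstants, h0, h2, h3]
      · simp [setVar_var, h5]
      · simp [setVar_var, h8]
      · simp
      · simp [setVar_var, h]
    · simp [setVar_var, h5, h2, h1, hEj] at h
      refine (runs_countNbrs (u := ⟨j, hj⟩) (S := L) ?_ ?_ ?_).mono le_rfl ?_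
      · simp [setVar_var, HasConstants, h0, h2, h3]
      · simp [setVar_var, h5]
      · rw [setVar_arr, harr 2 (by norm_num)]
        exact hL
      · rintro m'' ⟨hc'', h5'', h8'', harr'', h7''⟩
        refine hfinish m'' hc'' h5'' ?_ ?_ ?_
        · rw [h8'']; simp [setVar_var, h8]
        · rw [harr'']; simp
        · rw [h7'', if_neg h]
  · rintro m' - ⟨hc', h8, harr, hcnt⟩
    exact ⟨hc', h8, harr, fun u => hcnt u u.2⟩

/-- Mark in array `4` the greedy independent set of the vertices with entry `1` in array `3`. -/
def greedy : Program :=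
  .seq (forLoop 5 (.write 4 5 2)) (forLoop 5 (.seq (.read 6 3 5)
    (.ite 2 6 (.ite 3 6 .skip (.seq (countNbrs 4) (.ite 2 7 .skip (.write 4 5 3)))) .skip)))

lemma take_finRange_succ {j : ℕ} (hj : j < n) :
    (List.finRange n).take (j + 1) = (List.finRange n).take j ++ [⟨j, hj⟩] := by
  rw [List.take_add_one]
  simp [hj]

lemma runs_greedy {m : Memory} {R : Finset (Fin n)} (hc : HasConstants n m)
    (hR : ∀ u : Fin n, m.arr 3 u = 1 ↔ u ∈ R) :
    Runs G greedy m (n * (9 * n + 16) + 4) (fun m' => HasConstants n m' ∧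
      m'.var 8 = m.var 8 ∧ (∀ a, a ≠ 4 → m'.arr a = m.arr a) ∧
      Marks (m'.arr 4) (greedyIndepSet G R)) := by
  refine (runs_seq (T := n * 3 + 2) (T' := n * (9 * n + 13) + 2) ?_).mono
    (by ring_nf; omega) fun _ h => h
  refine (runs_forLoop (N := n) (T := 1) (fun j m' => HasConstants n m' ∧
      m'.var 8 = m.var 8 ∧ (∀ a, a ≠ 4 → m'.arr a = m.arr a) ∧
      ∀ u : Fin n, (u : ℕ) < j → m'.arr 4 u = 0)
      (by norm_num) hc.1 ?_ ?_ ?_)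
  · simpa [setVar_var, HasConstants] using hc
  · rintro j hj m' h5 h0 ⟨⟨-, h2, h3⟩, h8, harr, hclr⟩
    refine runs_write ⟨h5, h0, ?_, ?_, ?_, ?_⟩
    · simp [setVar_var, HasConstants, h0, h2, h3]
    · simp [setVar_var, h8]
    · intro a ha
      rw [setVar_arr, setArr_arr_of_ne _ _ _ _ ha, harr a ha]
    · intro u hu
      rw [setVar_arr, setArr_arr, h5, h2]
      by_cases huj : (u : ℕ) = j
      · simp [huj]
      · simpa [huj] using hclr u (by omega)
  rintro m₁ - ⟨hc₁, h8₁, harr₁, hclr₁⟩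
  refine (runs_forLoop (N := n) (T := 9 * n + 11) (fun j m' => HasConstants n m' ∧
      m'.var 8 = m.var 8 ∧ (∀ a, a ≠ 4 → m'.arr a = m.arr a) ∧
      Marks (m'.arr 4) (greedyPrefix G R ((List.finRange n).take j)))
      (by norm_num) hc₁.1 ?_ ?_ ?_)
  · refine ⟨?_, ?_, harr₁, ?_⟩
    · simpa [setVar_var, HasConstants] using hc₁
    · simpa [setVar_var] using h8₁
    · intro u
      simpa using hclr₁ u u.2
  · rintro j hj m' h5 h0 ⟨⟨-, h2, h3⟩, h8, harr, hmk⟩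
    set I := greedyPrefix G R ((List.finRange n).take j) with hI
    have hRj := hR ⟨j, hj⟩
    rw [← harr 3 (by norm_num)] at hRj
    simp only at hRj
    have hnext := greedyPrefix_concat G R ((List.finRange n).take j) ⟨j, hj⟩
    rw [← take_finRange_succ hj, ← hI] at hnext
    have hkeep : ∀ m'' : Memory, HasConstants n m'' → m''.var 5 = j → m''.var 8 = m.var 8 →
        m''.arr = m'.arr → (¬ (⟨j, hj⟩ ∈ R ∧ ∀ w ∈ I, ¬ G.Adj w ⟨j, hj⟩)) →
        (m''.var 5 = j ∧ m''.var 0 = n ∧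
          HasConstants n (m''.setVar 5 (j + 1)) ∧ (m''.setVar 5 (j + 1)).var 8 = m.var 8 ∧
          (∀ a, a ≠ 4 → (m''.setVar 5 (j + 1)).arr a = m.arr a) ∧
          Marks ((m''.setVar 5 (j + 1)).arr 4)
            (greedyPrefix G R ((List.finRange n).take (j + 1)))) := by
      intro m'' hc'' h5'' h8'' harr'' hno
      refine ⟨h5'', hc''.1, ?_, ?_, ?_, ?_⟩
      · simpa [setVar_var, HasConstants] using hc''
      · simpa [setVar_var] using h8''
      · intro a ha
        rw [setVar_arr, harr'', harr a ha]
      · rw [setVar_arr, harr'', hnext, if_neg hno]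
        exact hmk
    refine (runs_seq (runs_read (runs_ite (T := 9 * n + 8) (T' := 1) (fun h => ?_)
      fun h => runs_skip ?_))).mono (by omega) fun _ h => h
    -- Only comparisons are available, so the entry is recognised as 1 by being above 0 and not
    -- above 1.
    · refine (runs_ite (T := 1) (T' := 9 * n + 6) (fun h' => runs_skip ?_)
        fun h' => ?_).mono (by omega) fun _ h => h
      · simp [setVar_var, h5, h3] at h'
        refine hkeep _ ?_ ?_ ?_ ?_ ?_
        · simp [setVar_var, HasConstants, h0, h2, h3]
        · simp [setVar_var, h5]
        · simp [setVar_var, h8]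
        · simp
        · intro hno
          have := hRj.2 hno.1
          omega
      · simp [setVar_var, h5, h3, h2] at h h'
        have hjR : ⟨j, hj⟩ ∈ R := hRj.1 (by omega)
        refine runs_seq (T := 9 * n + 3) (T' := 3)
          ((runs_countNbrs (u := ⟨j, hj⟩) (S := I) ?_ ?_ ?_).mono le_rfl ?_)
        · simp [setVar_var, HasConstants, h0, h2, h3]
        · simp [setVar_var, h5]
        · simpa using hmk
        · rintro m'' ⟨hc'', h5'', h8'', harr'', h7''⟩
          simp only at h5''
          have h8m : m''.var 8 = m.var 8 := by rw [h8'']; simp [setVar_var, h8]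
          refine runs_ite (T := 1) (T' := 1) (fun hpos => runs_skip ?_) fun hpos => runs_write ?_
          · refine hkeep _ hc'' h5'' h8m harr'' ?_
            rw [hc''.2.1, h7'', Finset.card_pos] at hpos
            obtain ⟨w, hw⟩ := hpos
            rw [mem_nbrsIn] at hw
            exact fun hno => hno.2 w hw.1 hw.2
          · rw [hc''.2.1, h7'', Finset.card_pos, Finset.not_nonempty_iff_eq_empty] at hpos
            have hno : ⟨j, hj⟩ ∈ R ∧ ∀ w ∈ I, ¬ G.Adj w ⟨j, hj⟩ := by
              refine ⟨hjR, fun w hw hadj => ?_⟩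
              have : w ∈ nbrsIn G I ⟨j, hj⟩ := mem_nbrsIn.2 ⟨hw, hadj⟩
              rw [hpos] at this
              simp at this
            refine ⟨h5'', hc''.1, ?_, ?_, ?_, ?_⟩
            · simpa [setVar_var, HasConstants] using hc''
            · simpa [setVar_var] using h8m
            · intro a ha
              rw [setVar_arr, setArr_arr_of_ne _ _ _ _ ha, harr'', setVar_arr, harr a ha]
            · rw [hnext, if_pos hno]
              intro u
              rw [setVar_arr, setArr_arr, h5'', hc''.2.2, harr'', setVar_arr, hmk u]
              by_cases huj : (u : ℕ) = j
              · have : u = ⟨j, hj⟩ := Fin.ext huj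
                subst this
                simp
              · have : u ≠ ⟨j, hj⟩ := fun h => huj (by rw [h])
                simp [huj, this]
    · simp [setVar_var, h5, h2] at h
      refine hkeep _ ?_ ?_ ?_ ?_ ?_
      · simp [setVar_var, HasConstants, h0, h2, h3]
      · simp [setVar_var, h5]
      · simp [setVar_var, h8]
      · simp
      · intro hno
        have := hRj.2 hno.1
        omega
  · rintro m' - ⟨hc', h8, harr, hmk⟩
    refine ⟨hc', h8, harr, ?_⟩
    rwa [List.take_of_length_le (by simp), greedyPrefix_finRange] at hmk

/-- Mark the vertices with a positive entry in array `3` in array `1`, copy the marks of array `4`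
to array `2`, and unmark them in array `0`. -/
def advance : Program :=
  forLoop 5 (.seq (.read 6 3 5) (.seq (.ite 2 6 (.write 1 5 3) .skip)
    (.seq (.read 6 4 5) (.seq (.write 2 5 6) (.ite 2 6 (.write 0 5 2) .skip)))))

lemma runs_advance {m : Memory} {E K L D : Finset (Fin n)} (hc : HasConstants n m)
    (hE : Marks (m.arr 1) E) (hD : Marks (m.arr 0) D) (hL : Marks (m.arr 4) L)
    (hK : ∀ u : Fin n, 0 < m.arr 3 u ↔ u ∈ K) :
    Runs G advance m (n * 11 + 2) (fun m' => HasConstants n m' ∧ m'.var 8 = m.var 8 ∧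
      Marks (m'.arr 1) (E ∪ K) ∧ Marks (m'.arr 2) L ∧ Marks (m'.arr 0) (D \ L)) := by
  -- Arrays 0 and 1 are updated in place and are described at every vertex; array 2 is described
  -- only below j, since further on it still holds the old level.
  refine (runs_forLoop (N := n) (T := 9) (fun j m' => HasConstants n m' ∧
      m'.var 8 = m.var 8 ∧ m'.arr 3 = m.arr 3 ∧ m'.arr 4 = m.arr 4 ∧
      Marks (m'.arr 1) (E ∪ below K j) ∧
      (∀ u : Fin n, (u : ℕ) < j → m'.arr 2 u = if u ∈ L then 1 else 0) ∧
      Marks (m'.arr 0) (D \ below L j))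
      (by norm_num) hc.1 ?_ ?_ ?_)
  · refine ⟨?_, ?_, rfl, rfl, ?_, ?_, ?_⟩
    · simpa [setVar_var, HasConstants] using hc
    · simp [setVar_var]
    · simpa using hE
    · simp
    · simpa using hD
  · rintro j hj m' h5 h0 ⟨⟨-, h2, h3⟩, h8, ha3, ha4, ha1, ha2, ha0⟩
    have hKj := hK ⟨j, hj⟩
    have hLj := hL ⟨j, hj⟩
    simp only at hKj hLj
    have hbelow : ∀ (S : Finset (Fin n)) (u : Fin n), u ∈ below S (j + 1) ↔
        u ∈ below S j ∨ (u : ℕ) = j ∧ ⟨j, hj⟩ ∈ S := by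
      intro S u
      rw [below_succ S hj]
      split_ifs with h <;> simp [h, Fin.ext_iff, or_comm]
    have hlast : ∀ m'' : Memory, HasConstants n m'' → m''.var 5 = j → m''.var 8 = m.var 8 →
        m''.arr 3 = m.arr 3 → m''.arr 4 = m.arr 4 → m''.arr 2 = m'.arr 2 → m''.arr 0 = m'.arr 0 →
        Marks (m''.arr 1) (E ∪ below K (j + 1)) →
        Runs G (.seq (.read 6 4 5) (.seq (.write 2 5 6) (.ite 2 6 (.write 0 5 2) .skip))) m'' 5
          (fun m' => m'.var 5 = j ∧ m'.var 0 = n ∧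
            HasConstants n (m'.setVar 5 (j + 1)) ∧ (m'.setVar 5 (j + 1)).var 8 = m.var 8 ∧
            (m'.setVar 5 (j + 1)).arr 3 = m.arr 3 ∧ (m'.setVar 5 (j + 1)).arr 4 = m.arr 4 ∧
            Marks ((m'.setVar 5 (j + 1)).arr 1) (E ∪ below K (j + 1)) ∧
            (∀ u : Fin n, (u : ℕ) < j + 1 →
              (m'.setVar 5 (j + 1)).arr 2 u = if u ∈ L then 1 else 0) ∧
            Marks ((m'.setVar 5 (j + 1)).arr 0) (D \ below L (j + 1))) := by
      rintro m'' ⟨h0'', h2'', h3''⟩ h5'' h8'' hb3 hb4 hb2 hb0 hb1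
      have hnew : ∀ u : Fin n, (u : ℕ) < j + 1 →
          (if (u : ℕ) = j then (if ⟨j, hj⟩ ∈ L then 1 else 0) else m'.arr 2 u) =
            if u ∈ L then 1 else 0 := by
        intro u hu
        by_cases huj : (u : ℕ) = j
        · have : u = ⟨j, hj⟩ := Fin.ext huj
          subst this
          simp
        · simpa [huj] using ha2 u (by omega)
      refine runs_seq (runs_read (runs_seq (runs_write
        (runs_ite (T := 1) (T' := 1) (fun h => runs_write ?_) fun h => runs_skip ?_))))
      · simp [setVar_var, h5'', h2'', hb4, hLj, zero_lt_ite_iff] at h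
        refine ⟨?_, ?_, ?_, ?_, ?_, ?_, ?_, ?_, ?_⟩
        · simp [setVar_var, h5'']
        · simp [setVar_var, h0'']
        · simp [setVar_var, HasConstants, h0'', h2'', h3'']
        · simp [setVar_var, h8'']
        · simp [setArr_arr_of_ne, hb3]
        · simp [setArr_arr_of_ne, hb4]
        · simpa [setArr_arr_of_ne] using hb1
        · intro u hu
          rw [← hnew u hu]
          simp [setArr_arr, setVar_var, h5'', hb4, hLj, hb2]
        · intro u
          have h' := ha0 u
          simp only [Finset.mem_sdiff] at h'
          simp only [setVar_arr, setArr_arr, setArr_var, setVar_var, h5'', h2'', hb0, h',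
            Finset.mem_sdiff, hbelow]
          by_cases huj : (u : ℕ) = j <;> simp [huj, h]
      · simp [setVar_var, h5'', h2'', hb4, hLj] at h
        refine ⟨?_, ?_, ?_, ?_, ?_, ?_, ?_, ?_, ?_⟩
        · simp [setVar_var, h5'']
        · simp [setVar_var, h0'']
        · simp [setVar_var, HasConstants, h0'', h2'', h3'']
        · simp [setVar_var, h8'']
        · simp [setArr_arr_of_ne, hb3]
        · simp [setArr_arr_of_ne, hb4]
        · simpa [setArr_arr_of_ne] using hb1
        · intro u hu
          rw [← hnew u hu]
          simp [setArr_arr, setVar_var, h5'', hb4, hLj, hb2]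
        · intro u
          have h' := ha0 u
          simp only [Finset.mem_sdiff] at h'
          simp [setArr_arr, hb0, h', Finset.mem_sdiff, hbelow, h]
    refine (runs_seq (runs_read (runs_seq (T := 3) (T' := 5)
      (runs_ite (T := 1) (T' := 1) (fun h => runs_write ?_) fun h => runs_skip ?_)))).mono
      (by omega) fun _ h => h
    · simp [setVar_var, h5, h2, ha3, hKj] at h
      refine hlast _ ?_ ?_ ?_ ?_ ?_ ?_ ?_ ?_
      · simp [setVar_var, HasConstants, h0, h2, h3]
      · simp [setVar_var, h5]
      · simp [setVar_var, h8]
      · simp [setArr_arr_of_ne, ha3]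
      · simp [setArr_arr_of_ne, ha4]
      · simp [setArr_arr_of_ne]
      · simp [setArr_arr_of_ne]
      · intro u
        have h' := ha1 u
        simp only [Finset.mem_union] at h'
        simp only [setVar_arr, setArr_arr, setVar_var, h5, h3, h', Finset.mem_union, hbelow]
        by_cases huj : (u : ℕ) = j <;> simp [huj, h]
    · simp [setVar_var, h5, h2, ha3] at h
      have hjK : ⟨j, hj⟩ ∉ K := fun h' => by have := hKj.2 h'; omega
      refine hlast _ ?_ ?_ ?_ ?_ ?_ ?_ ?_ ?_
      · simp [setVar_var, HasConstants, h0, h2, h3]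
      · simp [setVar_var, h5]
      · simp [setVar_var, h8]
      · simp [ha3]
      · simp [ha4]
      · simp
      · simp
      · intro u
        have h' := ha1 u
        simp only [Finset.mem_union] at h'
        simp [h', hbelow, hjK]
  · rintro m' - ⟨hc', h8, -, -, ha1, ha2, ha0⟩
    rw [below_card] at ha1 ha0
    exact ⟨hc', h8, ha1, fun u => ha2 u u.2, ha0⟩

end RAM

/-! ### The complete programs and their running times. -/

namespace RAM

open AugmentBFS

variable {n : ℕ} {G : SimpleGraph (Fin n)}

/-- The arrays `0`, `1` and `2` represent the state `s` of the exploration. -/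
def Represents (m : Memory) (s : State n) : Prop :=
  Marks (m.arr 0) (Finset.univ \ survivors s) ∧ Marks (m.arr 1) s.exposed ∧ Marks (m.arr 2) s.level

/-- One round of Augment-BFS. -/
def round : Program := .seq countFresh (.seq greedy advance)

lemma card_nbrsIn_eq_one_iff {L : Finset (Fin n)} {u : Fin n} :
    (nbrsIn G L u).card = 1 ↔ ∃! w, w ∈ L ∧ G.Adj w u := by
  rw [Finset.card_eq_one]
  constructor
  · rintro ⟨w, hw⟩
    have h := fun x => (Finset.ext_iff.1 hw) x
    simp only [mem_nbrsIn, Finset.mem_singleton] at h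
    exact ⟨w, (h w).2 rfl, fun y hy => (h y).1 hy⟩
  · rintro ⟨w, hw, hu⟩
    refine ⟨w, Finset.ext fun x => ?_⟩
    simp only [mem_nbrsIn, Finset.mem_singleton]
    exact ⟨fun hx => hu x hx, fun hx => hx ▸ hw⟩

lemma runs_round {m : Memory} {s : State n} (hs : Nested s) (hc : HasConstants n m)
    (hm : Represents m s) :
    Runs G round m (18 * n ^ 2 + 36 * n + 8) (fun m' => HasConstants n m' ∧ m'.var 8 = m.var 8 ∧
      Represents m' (step G s)) := by
  obtain ⟨hout, hexp, hlev⟩ := hm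
  refine (runs_seq ((runs_countFresh hc hexp hlev).mono le_rfl ?_)).mono
    (T := n * (9 * n + 9) + 2 + (n * (9 * n + 16) + 4 + (n * 11 + 2))) (by ring_nf; rfl)
    fun _ h => h
  rintro m₁ ⟨hc₁, h8₁, harr₁, hcnt⟩
  refine runs_seq ((runs_greedy (R := uniqueNeighbors G s) hc₁ fun u => ?_).mono le_rfl ?_)
  · rw [hcnt, mem_uniqueNeighbors, ← card_nbrsIn_eq_one_iff]
    split_ifs with h <;> simp [h]
  rintro m₂ ⟨hc₂, h8₂, harr₂, hmk⟩
  refine (runs_advance (E := s.exposed) (K := frontier G s)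
    (L := greedyIndepSet G (uniqueNeighbors G s)) (D := Finset.univ \ survivors s)
    hc₂ ?_ ?_ hmk fun u => ?_).mono le_rfl ?_
  · rw [harr₂ 1 (by norm_num), harr₁ 1 (by norm_num)]
    exact hexp
  · rw [harr₂ 0 (by norm_num), harr₁ 0 (by norm_num)]
    exact hout
  · rw [harr₂ 3 (by norm_num), hcnt, mem_frontier]
    split_ifs with h
    · simp [h]
    · rw [Finset.card_pos]
      simp [h, Finset.Nonempty, mem_nbrsIn]
  · rintro m₃ ⟨hc₃, h8₃, ha1, ha2, ha0⟩
    refine ⟨hc₃, by rw [h8₃, h8₂, h8₁], ?_, ha1, ha2⟩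
    -- Unmarking the new level turns the complement of the old survivors into that of the new ones,
    -- so no array for the deleted vertices is needed.
    rw [hs.survivors_step G]
    rwa [sdiff_sdiff_left] at ha0

/-- Augment-BFS, started at the vertex whose number is held by variable `1`. -/
def augmentBFS : Program :=
  .seq (.const 3 1) (.seq (forLoop 5 (.write 0 5 3)) (.seq (.write 0 1 2) (.seq (.write 1 1 3)
    (.seq (.write 2 1 3) (forLoop 8 round)))))

lemma runs_augmentBFS (v : Fin n) :
    Runs G augmentBFS (initial n v) (18 * n ^ 3 + 36 * n ^ 2 + 13 * n + 8)
      (fun m => ∀ u : Fin n, m.arr 0 u = 1 ↔ u ∈ output G v) := by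
  refine (runs_seq (T' := n * 3 + 2 + (1 + (1 + (1 + (n * (18 * n ^ 2 + 36 * n + 8 + 2) + 2)))))
    (runs_const ?_)).mono (by ring_nf; rfl) fun _ h => h
  refine runs_seq (runs_forLoop (N := n) (T := 1) (fun j m => HasConstants n m ∧ m.var 1 = v ∧
    (∀ a, a ≠ 0 → ∀ i, m.arr a i = 0) ∧ ∀ u : Fin n, (u : ℕ) < j → m.arr 0 u = 1)
    (by norm_num) ?_ ?_ ?_ ?_)
  · simp [setVar_var, initial]
  · simp [setVar_var, initial, HasConstants]
  · rintro j hj m h5 h0 ⟨⟨-, h2, h3⟩, h1, harr, hone⟩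
    refine runs_write ⟨h5, h0, ?_, ?_, ?_, ?_⟩
    · simp [setVar_var, HasConstants, h0, h2, h3]
    · simp [setVar_var, h1]
    · intro a ha i
      rw [setVar_arr, setArr_arr_of_ne _ _ _ _ ha, harr a ha]
    · intro u hu
      rw [setVar_arr, setArr_arr, h5, h3]
      by_cases huj : (u : ℕ) = j
      · simp [huj]
      · simpa [huj] using hone u (by omega)
  rintro m - ⟨⟨h0, h2, h3⟩, h1, harr, hone⟩
  have hv : ∀ u : Fin n, (u : ℕ) = v ↔ u = v := fun u => Fin.ext_iff.symm
  refine runs_seq (runs_write (runs_seq (runs_write (runs_seq (runs_write ?_)))))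
  refine runs_forLoop (N := n) (T := 18 * n ^ 2 + 36 * n + 8)
    (fun j m => HasConstants n m ∧ Represents m ((step G)^[j] (init v))) (by norm_num) ?_ ?_ ?_ ?_
  · simp [h0]
  · refine ⟨?_, ?_, ?_, ?_⟩
    · simp [setVar_var, HasConstants, h0, h2, h3]
    · intro u
      simp [setArr_arr, h1, h2, hone u u.2, survivors, init, hv]
    · intro u
      simp [setArr_arr, h1, h3, harr, init, hv]
    · intro u
      simp [setArr_arr, h1, h3, harr, init, hv]
  · rintro j hj m' h8 h0' ⟨hc', hm'⟩
    refine (runs_round (nested_iterate G v j) hc' hm').mono le_rfl ?_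
    rintro m'' ⟨hc'', h8'', hm''⟩
    refine ⟨h8''.trans h8, hc''.1, ?_, ?_⟩
    · simpa [setVar_var, HasConstants] using hc''
    · rw [Function.iterate_succ_apply']
      exact hm''
  · rintro m' - ⟨-, hm', -, -⟩ u
    rw [hm' u, output_eq_compl]
    simp

theorem computableInPolyTime_output :
    ComputableInPolyTime (fun _ G v => AugmentBFS.output G v) := by
  refine ⟨augmentBFS, 18 * Polynomial.X ^ 3 + 36 * Polynomial.X ^ 2 + 13 * Polynomial.X + 8,
    fun n G v => ?_⟩
  obtain ⟨t, m, he, ht, hm⟩ := runs_augmentBFS (G := G) v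
  exact ⟨t, m, he, by simpa using ht, hm⟩

/-- Mark the complement of the greedy independent set of the whole graph in array `0`. -/
def greedyComplement : Program :=
  .seq (.const 3 1) (.seq (forLoop 5 (.seq (.write 0 5 3) (.write 3 5 3))) (.seq greedy advance))

/-- Filling array 3 with ones makes every vertex a candidate, so `greedy` and `advance` can be
reused; the marks that `advance` leaves in arrays 1 and 2 play no role. -/
lemma runs_greedyComplement (v : Fin n) :
    Runs G greedyComplement (initial n v) (9 * n ^ 2 + 31 * n + 9)
      (fun m => ∀ u : Fin n, m.arr 0 u = 1 ↔ u ∈ Finset.univ \ greedyIndepSet G Finset.univ) := by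
  refine (runs_seq (T' := n * 4 + 2 + (n * (9 * n + 16) + 4 + (n * 11 + 2)))
    (runs_const ?_)).mono (by ring_nf; rfl) fun _ h => h
  refine runs_seq (runs_forLoop (N := n) (T := 2) (fun j m => HasConstants n m ∧
    (∀ a, a ≠ 0 → a ≠ 3 → ∀ i, m.arr a i = 0) ∧
    ∀ u : Fin n, (u : ℕ) < j → m.arr 0 u = 1 ∧ m.arr 3 u = 1)
    (by norm_num) ?_ ?_ ?_ ?_)
  · simp [setVar_var, initial]
  · simp [setVar_var, initial, HasConstants]
  · rintro j hj m h5 h0 ⟨⟨-, h2, h3⟩, harr, hone⟩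
    refine runs_seq (runs_write (runs_write ⟨h5, h0, ?_, ?_, ?_⟩))
    · simp [setVar_var, HasConstants, h0, h2, h3]
    · intro a ha ha3 i
      rw [setVar_arr, setArr_arr_of_ne _ _ _ _ ha3, setArr_arr_of_ne _ _ _ _ ha, harr a ha ha3]
    · intro u hu
      by_cases huj : (u : ℕ) = j
      · simp [setArr_arr, h5, h3, huj]
      · simpa [setArr_arr, h5, huj] using hone u (by omega)
  rintro m - ⟨hc, harr, hone⟩
  refine runs_seq ((runs_greedy (R := Finset.univ) hc fun u => ?_).mono le_rfl ?_)
  · simp [(hone u u.2).2]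
  rintro m' ⟨hc', -, harr', hmk⟩
  refine (runs_advance (E := ∅) (K := Finset.univ) (D := Finset.univ) hc' ?_ ?_ hmk
    fun u => ?_).mono le_rfl ?_
  · intro u
    rw [harr' 1 (by norm_num), harr 1 (by norm_num) (by norm_num)]
    simp
  · intro u
    rw [harr' 0 (by norm_num), (hone u u.2).1]
    simp
  · rw [harr' 3 (by norm_num), (hone u u.2).2]
    simp
  · rintro m'' ⟨-, -, -, -, hm''⟩ u
    rw [hm'' u]
    simp

theorem computableInPolyTime_compl_greedyIndepSet :
    ComputableInPolyTime (fun _ G _ => Finset.univ \ greedyIndepSet G Finset.univ) := by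
  refine ⟨greedyComplement, 9 * Polynomial.X ^ 2 + 31 * Polynomial.X + 9, fun n G v => ?_⟩
  obtain ⟨t, m, he, ht, hm⟩ := runs_greedyComplement (G := G) v
  exact ⟨t, m, he, by simpa using ht, hm⟩

end RAM

theorem theorem1 :
    -- one polynomial time algorithm, for every edge probability `p = o(1)`
    (∃ F : (n : ℕ) → SimpleGraph (Fin n) → Finset (Fin n),
      RAM.ComputableInPolyTime (fun n G _ => F n G) ∧
      (∀ (n : ℕ) (G : SimpleGraph (Fin n)), IsFeedbackVertexSet G (F n G)) ∧
      ∀ p : ℕ → unitInterval, Tendsto (fun n => (p n : ℝ)) atTop (𝓝 0) →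
        ∃ η : ℕ → ℝ, Tendsto η atTop (𝓝 0) ∧
          ∀ᶠ n : ℕ in atTop,
            3 / 4 ≤ (SimpleGraph.binomialRandom (Fin n) (p n)).real
              {G | ((F n G).card : ℝ) ≤
                (n : ℝ) - 1 / (p n : ℝ) * Real.log ((n : ℝ) * (p n : ℝ)) * (1 - η n)}) ∧
    -- the guarantee for Augment-BFS, with an arbitrary starting vertex `v`
    RAM.ComputableInPolyTime (fun _ G v => AugmentBFS.output G v) ∧
    (∀ (n : ℕ) (G : SimpleGraph (Fin n)) (v : Fin n),
      IsFeedbackVertexSet G (AugmentBFS.output G v)) ∧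
    ∀ p : ℕ → unitInterval, Tendsto (fun n => (p n : ℝ)) atTop (𝓝 0) →
      Tendsto (fun n : ℕ => (n : ℝ) * (p n : ℝ)) atTop atTop →
      ∃ η : ℕ → ℝ, Tendsto η atTop (𝓝 0) ∧
        ∀ᶠ n : ℕ in atTop, ∀ v : Fin n,
          3 / 4 ≤ (SimpleGraph.binomialRandom (Fin n) (p n)).real
            {G | ((AugmentBFS.output G v).card : ℝ) ≤
              (n : ℝ) - 1 / (p n : ℝ) * Real.log ((n : ℝ) * (p n : ℝ)) * (1 - η n)} := by
  refine ⟨⟨fun _ G => Finset.univ \ AugmentBFS.greedyIndepSet G Finset.univ,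
    RAM.computableInPolyTime_compl_greedyIndepSet,
    fun _ G => AugmentBFS.isFeedbackVertexSet_compl_greedyIndepSet G Finset.univ,
    RandomGraph.greedyIndepSet_guarantee⟩,
    RAM.computableInPolyTime_output, fun _ G v => AugmentBFS.isFeedbackVertexSet_output G v,
    RandomGraph.augmentBFS_guarantee⟩
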